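/- Let $T>0$, $\nu>0$, $\mu>0$, $\alpha\ge 0$, $a<0<b$, $y_\Omega\in C[0,1]$, $Q=(0,1)\times(0,T)$, and $U_{ad}=\{u\in L^2(0,T): a\le u(t)\le b \text{ for a.a. } t\in[0,T]\}$. For $u\in U_{ad}$ let $y_u\in C(\bar Q)$, with $\partial_x y_u\in L^2(Q)$, be the weak solution of $$y_t-y_{xx}=0 \text{ in } Q,\quad y_x(0,t)=0,\quad y_x(1,t)+\alpha\,y(1,t)=u(t) \text{ in } (0,T),\quad y(x,0)=0 \text{ in } (0,1).$$ Let $u_\nu\in U_{ad}$ be optimal for $$\min_{u\in U_{ad}}\ \frac12\int_0^1|y_u(x,T)-y_\Omega(x)|^2\,dx+\frac{\nu}{2}\int_0^T|u(t)|^2\,dt+\mu\int_0^T|u(t)|\,dt,$$ and let $\varphi_\nu\in C(\bar Q)$, with $\partial_x\varphi_\nu\in L^2(Q)$, be the associated adjoint state, i.e. the weak solution of $$-\varphi_t-\varphi_{xx}=0 \text{ in } Q,\quad \varphi_x(0,t)=0,\quad \varphi_x(1,t)+\alpha\,\varphi(1,t)=0 \text{ in } (0,T),\quad \varphi(x,T)=y_{u_\nu}(x,T)-y_\Omega(x)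 \text{ in } (0,1).$$ Then for almost all $t\in[0,T]$ the following implications hold: $$\begin{aligned} \varphi_\nu(1,t)\in(-\infty,-\mu-\nu b)&\ \Rightarrow\ u_\nu(t)=b,\\ \varphi_\nu(1,t)\in(-\mu-\nu b,-\mu)&\ \Rightarrow\ u_\nu(t)=-\tfrac1\nu(\varphi_\nu(1,t)+\mu),\\ \varphi_\nu(1,t)\in(-\mu,\mu)&\ \Rightarrow\ u_\nu(t)=0,\\ \varphi_\nu(1,t)\in(\mu,\mu-\nu a)&\ \Rightarrow\ u_\nu(t)=-\tfrac1\nu(\varphi_\nu(1,t)-\mu),\\ \varphi_\nu(1,t)\in(\mu-\nu a,\infty)&\ \Rightarrow\ u_\nu(t)=a. \end{aligned}$$ -/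

import Mathlib

open MeasureTheory Set

namespace SparseHeatControl

/-- The open space-time cylinder `Q = (0,1) × (0,T)`; points are pairs `(x, t)`. -/
def cylinder (T : ℝ) : Set (ℝ × ℝ) := Ioo (0 : ℝ) 1 ×ˢ Ioo (0 : ℝ) T

/-- `g ∈ L²(Q)` is the weak (distributional) derivative of `y` with respect to `x` on `Q`, tested
with all `η ∈ C¹_c(Q)`. -/
def HasWeakDerivX (T : ℝ) (y g : ℝ → ℝ → ℝ) : Prop :=
  MemLp (fun p : ℝ × ℝ => g p.1 p.2) 2 (volume.restrict (cylinder T)) ∧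
  ∀ η : ℝ → ℝ → ℝ,
    ContDiff ℝ 1 (fun p : ℝ × ℝ => η p.1 p.2) →
    HasCompactSupport (fun p : ℝ × ℝ => η p.1 p.2) →
    tsupport (fun p : ℝ × ℝ => η p.1 p.2) ⊆ cylinder T →
    ∫ p in cylinder T, y p.1 p.2 * deriv (fun x => η x p.2) p.1
      = - ∫ p in cylinder T, g p.1 p.2 * η p.1 p.2

/-- `y` is the state belonging to the boundary control `u`: the weak solution, continuous on the
closed cylinder and with `y_x ∈ L²(Q)`, of
`y_t - y_xx = 0` in `Q`, `y_x(0,t) = 0`, `y_x(1,t) + α y(1,t) = u(t)`, `y(x,0) = 0`.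
Test functions are the `v ∈ C¹`, with no condition at `t = T`, so that the value `y(·,T)` occurs
in the identity; the term `∫ y(x,0) v(x,0) dx` vanishes by the initial condition. -/
structure IsState (T α : ℝ) (u : ℝ → ℝ) (y : ℝ → ℝ → ℝ) : Prop where
  continuousOn : ContinuousOn (fun p : ℝ × ℝ => y p.1 p.2) (Icc (0 : ℝ) 1 ×ˢ Icc (0 : ℝ) T)
  initial : ∀ x ∈ Icc (0 : ℝ) 1, y x 0 = 0
  weak : ∃ g : ℝ → ℝ → ℝ, HasWeakDerivX T y g ∧
    ∀ v : ℝ → ℝ → ℝ, ContDiff ℝ 1 (fun p : ℝ × ℝ => v p.1 p.2) →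
      (∫ x in (0 : ℝ)..1, y x T * v x T)
        - (∫ p in cylinder T, y p.1 p.2 * deriv (fun t => v p.1 t) p.2)
        + (∫ p in cylinder T, g p.1 p.2 * deriv (fun x => v x p.2) p.1)
        + α * (∫ t in (0 : ℝ)..T, y 1 t * v 1 t)
      = ∫ t in (0 : ℝ)..T, u t * v 1 t

/-- `φ` is the weak solution, continuous on the closed cylinder and with `φ_x ∈ L²(Q)`, of the
backward problem `-φ_t - φ_xx = 0` in `Q`, `φ_x(0,t) = 0`, `φ_x(1,t) + α φ(1,t) = 0`,
`φ(x,T) = d(x)`. -/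
structure IsAdjointState (T α : ℝ) (d : ℝ → ℝ) (φ : ℝ → ℝ → ℝ) : Prop where
  continuousOn : ContinuousOn (fun p : ℝ × ℝ => φ p.1 p.2) (Icc (0 : ℝ) 1 ×ˢ Icc (0 : ℝ) T)
  terminal : ∀ x ∈ Icc (0 : ℝ) 1, φ x T = d x
  weak : ∃ g : ℝ → ℝ → ℝ, HasWeakDerivX T φ g ∧
    ∀ v : ℝ → ℝ → ℝ, ContDiff ℝ 1 (fun p : ℝ × ℝ => v p.1 p.2) →
      (∫ x in (0 : ℝ)..1, φ x 0 * v x 0)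
        + (∫ p in cylinder T, φ p.1 p.2 * deriv (fun t => v p.1 t) p.2)
        + (∫ p in cylinder T, g p.1 p.2 * deriv (fun x => v x p.2) p.1)
        + α * (∫ t in (0 : ℝ)..T, φ 1 t * v 1 t)
      = ∫ x in (0 : ℝ)..1, d x * v x T

/-- The admissible set `U_ad = {u ∈ L²(0,T) : a ≤ u(t) ≤ b for a.a. t}`. -/
def IsAdmissible (T a b : ℝ) (u : ℝ → ℝ) : Prop :=
  MemLp u 2 (volume.restrict (Icc (0 : ℝ) T)) ∧
  ∀ᵐ t ∂(volume.restrict (Icc (0 : ℝ) T)), a ≤ u t ∧ u t ≤ b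

/-- The objective functional
`J(y,u) = ½ ∫ |y(x,T) - y_Ω(x)|² dx + (ν/2) ∫ |u|² dt + μ ∫ |u| dt`. -/
noncomputable def cost (T ν μ : ℝ) (yΩ : ℝ → ℝ) (y : ℝ → ℝ → ℝ) (u : ℝ → ℝ) : ℝ :=
  (1 / 2) * (∫ x in (0 : ℝ)..1, |y x T - yΩ x| ^ 2)
    + (ν / 2) * (∫ t in (0 : ℝ)..T, |u t| ^ 2)
    + μ * (∫ t in (0 : ℝ)..T, |u t|)

/-- `u` is an optimal control with associated optimal state `y`: `(y, u)` minimizes `cost` among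
all pairs consisting of an admissible control and its state. -/
structure IsOptimal (T α ν μ a b : ℝ) (yΩ : ℝ → ℝ) (u : ℝ → ℝ) (y : ℝ → ℝ → ℝ) : Prop where
  admissible : IsAdmissible T a b u
  state : IsState T α u y
  minimal : ∀ (w : ℝ → ℝ) (z : ℝ → ℝ → ℝ), IsAdmissible T a b w → IsState T α w z →
    cost T ν μ yΩ y u ≤ cost T ν μ yΩ z w

end SparseHeatControl

/-!
Optimality of `u` is tested in the directions `w - u` with `w` admissible. Since `w - u` is
bounded, its state `z` can be constructed: for a Neumann flux `q` the solution is a cosine series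
whose coefficients are given by Duhamel's formula, and the Robin flux `q = h - α z(1, ·)` is the
fixed point of a map that contracts in an exponentially weighted norm.

The duality `∫ d z(·, T) = ∫ φ(1, ·) h` is proved on cosine coefficients: those of `φ` solve a
linear ODE, obtained by testing with `cos (nπx)` times a function of time. To sum up, one uses that
the function `W x = ∫ φ(x, t) q(t) dt` is continuous and that its cosine series converges, so that
the series sums to `W 1`.

The resulting variational inequality involves, at each time, the strongly convex function
`r ↦ p r + (ν/2) r² + μ |r|` on `[a,b]` with `p = φ(1, t)`; strong monotonicity forces `u(t)` to be
its minimiser, which is an explicit function of `p`.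
-/

namespace SparseHeatControl

open Filter
open scoped Real Topology

/-! ### Cosine series -/

/-- The `k`-th cosine coefficient of a function on `[0,1]`. -/
noncomputable def cosCoeff (f : ℝ → ℝ) (k : ℕ) : ℝ :=
  ∫ x in (0 : ℝ)..1, Real.cos (k * π * x) * f x

/-- The normalisation `‖cos(kπ·)‖⁻²` in `L²(0,1)`. -/
noncomputable def cosWeight (k : ℕ) : ℝ := if k = 0 then 1 else 2

/-- The normalised value of `cos(kπ·)` at the right end point. -/
noncomputable def endWeight (k : ℕ) : ℝ := cosWeight k * Real.cos (k * π)

lemma one_le_cosWeight (k : ℕ) : 1 ≤ cosWeight k := by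
  unfold cosWeight; split_ifs <;> norm_num

lemma cosWeight_nonneg (k : ℕ) : 0 ≤ cosWeight k := zero_le_one.trans (one_le_cosWeight k)

lemma cosWeight_le (k : ℕ) : cosWeight k ≤ 2 := by
  unfold cosWeight; split_ifs <;> norm_num

lemma abs_endWeight (k : ℕ) : |endWeight k| = cosWeight k := by
  rw [endWeight, Real.cos_nat_mul_pi, abs_mul, abs_neg_one_pow, mul_one,
    abs_of_nonneg (cosWeight_nonneg k)]

lemma endWeight_mul_cos (k : ℕ) : endWeight k * Real.cos (k * π) = cosWeight k := by
  rw [endWeight, mul_assoc, Real.cos_nat_mul_pi, ← mul_pow, neg_one_mul, neg_neg, one_pow, mul_one]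

instance fact_zero_lt_two : Fact (0 < (2 : ℝ)) := ⟨two_pos⟩

/-- The 2-periodic even extension of `f` from `[0,1]`; it is complex-valued so that the theory of
Fourier series on the circle applies. -/
noncomputable def evenExtension (f : ℝ → ℝ) : AddCircle (2 : ℝ) → ℂ :=
  AddCircle.liftIco 2 (-1) fun x => (f |x| : ℂ)

section EvenExtension

variable {f : ℝ → ℝ}

lemma evenExtension_coe {x : ℝ} (hx : x ∈ Ico (-1 : ℝ) 1) :
    evenExtension f (x : AddCircle (2 : ℝ)) = f |x| :=
  AddCircle.liftIco_coe_apply (f := fun x : ℝ => (f |x| : ℂ)) (by norm_num at hx ⊢; exact hx)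

lemma continuousOn_comp_abs (hf : ContinuousOn f (Icc 0 1)) :
    ContinuousOn (fun x : ℝ => (f |x| : ℂ)) (Icc (-1) 1) :=
  Complex.continuous_ofReal.comp_continuousOn <|
    hf.comp continuous_abs.continuousOn fun _ hx => ⟨abs_nonneg _, abs_le.2 hx⟩

lemma continuous_evenExtension (hf : ContinuousOn f (Icc 0 1)) :
    Continuous (evenExtension f) := by
  have htwo : (-1 : ℝ) + 2 = 1 := by norm_num
  refine AddCircle.liftIco_continuous ?_ ?_ <;> rw [htwo]
  · rw [abs_neg]
  · exact continuousOn_comp_abs hf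

lemma integral_neg_self {E : Type*} [NormedAddCommGroup E] [NormedSpace ℝ E] {h : ℝ → E} {r : ℝ}
    (hh : IntervalIntegrable h volume (-r) r) :
    ∫ x in -r..r, h x = ∫ x in (0 : ℝ)..r, (h x + h (-x)) := by
  have h0 : (0 : ℝ) ∈ uIcc (-r) r := by
    rcases le_total 0 r with hr | hr <;> simp [hr]
  have hl := hh.mono_set (uIcc_subset_uIcc_left h0)
  have hr := hh.mono_set (uIcc_subset_uIcc_right h0)
  have hl' : IntervalIntegrable (fun x => h (-x)) volume 0 r := by
    simpa using hl.comp_mul_left (c := -1) |>.symm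
  rw [← intervalIntegral.integral_add_adjacent_intervals hl hr,
    intervalIntegral.integral_add hr hl', add_comm, intervalIntegral.integral_comp_neg, neg_zero]

lemma cos_natAbs_mul (n : ℤ) (x : ℝ) : Real.cos (n.natAbs * x) = Real.cos (n * x) := by
  rw [Nat.cast_natAbs, Int.cast_abs]
  rcases abs_choice (n : ℝ) with h | h <;> rw [h]
  rw [neg_mul, Real.cos_neg]

lemma fourierCoeff_evenExtension (hf : ContinuousOn f (Icc 0 1)) (n : ℤ) :
    fourierCoeff (evenExtension f) n = cosCoeff f n.natAbs := by
  have hchar (x : ℝ) : (fourier (-n) (x : AddCircle (2 : ℝ)) : ℂ)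
      = Complex.exp (-(n * π * x : ℝ) * Complex.I) := by
    rw [fourier_coe_apply]; congr 1; push_cast; ring
  have hint : IntervalIntegrable
      (fun x : ℝ => Complex.exp (-(n * π * x : ℝ) * Complex.I) * f |x|) volume (-1) 1 := by
    refine ContinuousOn.intervalIntegrable (ContinuousOn.mul (by fun_prop) ?_)
    rw [uIcc_of_le (by norm_num)]
    exact continuousOn_comp_abs hf
  calc fourierCoeff (evenExtension f) n
      = (1 / 2 : ℝ) • ∫ x in (-1 : ℝ)..1, Complex.exp (-(n * π * x : ℝ) * Complex.I) * f |x| := by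
        rw [fourierCoeff_eq_intervalIntegral _ _ (-1), show (-1 : ℝ) + 2 = 1 by norm_num]
        congr 1
        refine intervalIntegral.integral_congr_Ioo_of_le (by norm_num) fun x hx => ?_
        rw [hchar, evenExtension_coe (Ioo_subset_Ico_self hx), smul_eq_mul]
    _ = cosCoeff f n.natAbs := by
        rw [integral_neg_self hint, cosCoeff, ← intervalIntegral.integral_ofReal,
          ← intervalIntegral.integral_smul]
        refine intervalIntegral.integral_congr fun x hx => ?_
        rw [uIcc_of_le zero_le_one] at hx
        have htwo := Complex.two_cos ((n * π * x : ℝ) : ℂ)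
        simp only [abs_neg, abs_of_nonneg hx.1, mul_neg, mul_assoc _ π, cos_natAbs_mul,
          Complex.ofReal_neg, neg_neg, ← add_mul, Complex.real_smul] at htwo ⊢
        rw [add_comm, ← htwo]
        push_cast; ring

lemma hasSum_nat_of_hasSum_natAbs {F : ℕ → ℝ} {a : ℝ} (h : HasSum (fun n : ℤ => F n.natAbs) a) :
    HasSum (fun k => cosWeight k * F k) a := by
  have hfold := h.nat_add_neg.add (hasSum_ite_eq (0 : ℕ) (-F 0))
  convert! hfold using 1
  · ext k
    rcases eq_or_ne k 0 with rfl | hk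
    · simp [cosWeight]
    · simp [cosWeight, hk, two_mul]
  · simp

theorem hasSum_cosCoeff (hf : ContinuousOn f (Icc 0 1)) (hs : Summable (cosCoeff f)) {x : ℝ}
    (hx : x ∈ Icc (0 : ℝ) 1) :
    HasSum (fun k => cosWeight k * (cosCoeff f k * Real.cos (k * π * x))) (f x) := by
  let F : C(AddCircle (2 : ℝ), ℂ) := ⟨_, continuous_evenExtension hf⟩
  have hcoeff (n : ℤ) : fourierCoeff F n = cosCoeff f n.natAbs := fourierCoeff_evenExtension hf n
  have hsum : Summable (fourierCoeff F) := by
    simp_rw [funext hcoeff]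
    exact Complex.ofRealCLM.summable (Summable.of_nat_of_neg (f := fun n : ℤ => cosCoeff f n.natAbs)
      (by simpa using hs) (by simpa using hs))
  have hval : F ((-x : ℝ) : AddCircle (2 : ℝ)) = f x := by
    refine (evenExtension_coe (f := f) ⟨neg_le_neg hx.2, by linarith [hx.1]⟩).trans ?_
    rw [abs_neg, abs_of_nonneg hx.1]
  have hchar (n : ℤ) :
      (fourier n ((-x : ℝ) : AddCircle (2 : ℝ)) : ℂ).re = Real.cos (n * (π * x)) := by
    rw [fourier_coe_apply,
      show (2 * π * Complex.I * n * (-x : ℝ) / (2 : ℝ) : ℂ) = (-(n * (π * x)) : ℝ) * Complex.I by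
        push_cast; ring, Complex.exp_ofReal_mul_I_re, Real.cos_neg]
  refine hasSum_nat_of_hasSum_natAbs (F := fun k => cosCoeff f k * Real.cos (k * π * x)) ?_
  have hre := Complex.hasSum_re (has_pointwise_sum_fourier_series_of_summable hsum (-x : ℝ))
  rw [hval, Complex.ofReal_re] at hre
  refine hre.congr_fun ?_
  intro n
  rw [hcoeff, smul_eq_mul, Complex.re_ofReal_mul, hchar, mul_assoc _ π, cos_natAbs_mul]

end EvenExtension

/-! ### Duhamel's formula -/

/-- The solution of `a' = -m a + q`, `a(0) = 0`. -/
noncomputable def duhamel (m : ℝ) (q : ℝ → ℝ) (t : ℝ) : ℝ :=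
  ∫ s in (0 : ℝ)..t, Real.exp (-m * (t - s)) * q s

lemma intervalIntegrable_of_bounded {q : ℝ → ℝ} (hq : Measurable q) {C : ℝ}
    (hC : ∀ t, |q t| ≤ C) (a b : ℝ) : IntervalIntegrable q volume a b :=
  intervalIntegrable_iff.2 <|
    Measure.integrableOn_of_bounded (M := C) (by simp [uIoc]) hq.aestronglyMeasurable
      (ae_of_all _ hC)

lemma duhamel_eq (m : ℝ) (q : ℝ → ℝ) (t : ℝ) :
    duhamel m q t = Real.exp (-m * t) * ∫ s in (0 : ℝ)..t, Real.exp (m * s) * q s := by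
  rw [duhamel, ← intervalIntegral.integral_const_mul]
  congr 1; ext s
  rw [← mul_assoc, ← Real.exp_add]; congr 2; ring

lemma duhamel_eq_exp_mul_duhamel_add (m γ : ℝ) (q : ℝ → ℝ) (t : ℝ) :
    duhamel m q t = Real.exp (γ * t) * duhamel (m + γ) (fun s => Real.exp (-γ * s) * q s) t := by
  rw [duhamel, duhamel, ← intervalIntegral.integral_const_mul]
  congr 1; ext s
  rw [← mul_assoc, ← mul_assoc, ← Real.exp_add, ← Real.exp_add]; congr 2; ring

lemma duhamel_zero (m : ℝ) (q : ℝ → ℝ) : duhamel m q 0 = 0 := intervalIntegral.integral_same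

lemma duhamel_congr {q r : ℝ → ℝ} {t : ℝ} (ht : 0 ≤ t) (h : ∀ s ∈ Icc 0 t, q s = r s) (m : ℝ) :
    duhamel m q t = duhamel m r t := by
  refine intervalIntegral.integral_congr fun s hs => ?_
  rw [uIcc_of_le ht] at hs
  simp only [h s hs]

lemma duhamel_sub {q r : ℝ → ℝ} {t : ℝ} (hq : IntervalIntegrable q volume 0 t)
    (hr : IntervalIntegrable r volume 0 t) (m : ℝ) :
    duhamel m (fun s => q s - r s) t = duhamel m q t - duhamel m r t := by
  rw [duhamel, duhamel, duhamel, ← intervalIntegral.integral_sub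
    (hq.continuousOn_mul (by fun_prop)) (hr.continuousOn_mul (by fun_prop))]
  congr 1; ext s; ring

lemma continuous_duhamel {q : ℝ → ℝ} (hq : ∀ a b, IntervalIntegrable q volume a b) (m : ℝ) :
    Continuous (duhamel m q) := by
  rw [funext (duhamel_eq m q)]
  exact Continuous.mul (by fun_prop) <| intervalIntegral.continuous_primitive
    (fun a b => (hq a b).continuousOn_mul (by fun_prop)) 0

lemma integral_exp_neg_mul_le {m : ℝ} (hm : 0 < m) (t : ℝ) :
    ∫ s in (0 : ℝ)..t, Real.exp (-m * (t - s)) ≤ 1 / m := by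
  have hderiv (s : ℝ) : HasDerivAt (fun s => Real.exp (-m * (t - s)) / m)
      (Real.exp (-m * (t - s))) s := by
    convert! ((((hasDerivAt_id s).const_sub t).const_mul (-m)).exp.div_const m) using 1
    field_simp; rfl
  rw [intervalIntegral.integral_eq_sub_of_hasDerivAt (fun s _ => hderiv s)
    (Continuous.intervalIntegrable (by fun_prop) _ _), sub_self, mul_zero, Real.exp_zero]
  exact sub_le_self _ (by positivity)

lemma abs_duhamel_le {q : ℝ → ℝ} {m C t : ℝ} (hm : 0 < m) (ht : 0 ≤ t)
    (hC : ∀ s ∈ Icc 0 t, |q s| ≤ C) : |duhamel m q t| ≤ C / m := by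
  have hC0 : 0 ≤ C := (abs_nonneg _).trans (hC 0 ⟨le_rfl, ht⟩)
  calc |duhamel m q t| ≤ ∫ s in (0 : ℝ)..t, Real.exp (-m * (t - s)) * C := by
        have hbound : Continuous fun s => Real.exp (-m * (t - s)) * C := by fun_prop
        rw [duhamel, ← Real.norm_eq_abs]
        refine intervalIntegral.norm_integral_le_of_norm_le ht (ae_of_all _ fun s hs => ?_)
          (hbound.intervalIntegrable _ _)
        rw [Real.norm_eq_abs, abs_mul, abs_of_pos (Real.exp_pos _)]
        exact mul_le_mul_of_nonneg_left (hC s (Ioc_subset_Icc_self hs)) (Real.exp_pos _).le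
    _ = (∫ s in (0 : ℝ)..t, Real.exp (-m * (t - s))) * C :=
        intervalIntegral.integral_mul_const _ _
    _ ≤ 1 / m * C := mul_le_mul_of_nonneg_right (integral_exp_neg_mul_le hm t) hC0
    _ = C / m := one_div_mul_eq_div m C

lemma abs_duhamel_le_div_add_one {q : ℝ → ℝ} {m C T t : ℝ} (hm : 0 ≤ m) (ht : t ∈ Icc 0 T)
    (hC : ∀ s, |q s| ≤ C) : |duhamel m q t| ≤ Real.exp T * C / (m + 1) := by
  rw [duhamel_eq_exp_mul_duhamel_add m 1, abs_mul, abs_of_pos (Real.exp_pos _), mul_div_assoc]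
  refine mul_le_mul (Real.exp_le_exp.2 (by linarith [ht.2])) ?_ (abs_nonneg _) (Real.exp_pos _).le
  refine abs_duhamel_le (by linarith) ht.1 fun s hs => ?_
  rw [abs_mul, abs_of_pos (Real.exp_pos _), ← one_mul C]
  exact mul_le_mul (Real.exp_le_one_iff.2 (by linarith [hs.1])) (hC s) (abs_nonneg _) zero_le_one

lemma mul_integral_eq_integral_deriv_mul_add {G G' Q : ℝ → ℝ} {T : ℝ}
    (hG : ∀ t, HasDerivAt G (G' t) t) (hG' : Continuous G')
    (hQ : IntervalIntegrable Q volume 0 T) :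
    G T * ∫ s in (0 : ℝ)..T, Q s
      = (∫ t in (0 : ℝ)..T, G' t * ∫ s in (0 : ℝ)..t, Q s) + ∫ t in (0 : ℝ)..T, G t * Q t := by
  have hderiv : deriv G = G' := funext fun t => (hG t).deriv
  have hGac : AbsolutelyContinuousOnInterval G 0 T :=
    (contDiff_one_iff_deriv.2 ⟨fun t => (hG t).differentiableAt, hderiv ▸ hG'⟩).contDiffOn
      |>.absolutelyContinuousOnInterval
  have hparts := hGac.integral_mul_deriv_eq_deriv_mul
    (hQ.absolutelyContinuousOnInterval_intervalIntegral (c := 0) left_mem_uIcc)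
  have hprim : ∫ t in (0 : ℝ)..T, G t * deriv (fun t => ∫ s in (0 : ℝ)..t, Q s) t
      = ∫ t in (0 : ℝ)..T, G t * Q t := by
    refine intervalIntegral.integral_congr_ae ?_
    filter_upwards [hQ.ae_hasDerivAt_integral] with t ht ht'
    rw [(ht (uIoc_subset_uIcc ht') 0 left_mem_uIcc).deriv]
  rw [hprim, hderiv, intervalIntegral.integral_same, mul_zero, sub_zero] at hparts
  rw [hparts]; ring

lemma mul_duhamel_eq {q F F' : ℝ → ℝ} {T : ℝ} (hq : IntervalIntegrable q volume 0 T) (m : ℝ)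
    (hF : ∀ t, HasDerivAt F (F' t) t) (hF' : Continuous F') :
    F T * duhamel m q T =
      (∫ t in (0 : ℝ)..T, (F' t - m * F t) * duhamel m q t) + ∫ t in (0 : ℝ)..T, F t * q t := by
  have hFc : Continuous F := continuous_iff_continuousAt.2 fun t => (hF t).continuousAt
  have hG (t : ℝ) : HasDerivAt (fun t => Real.exp (-m * t) * F t)
      (Real.exp (-m * t) * (F' t - m * F t)) t := by
    have hexp : HasDerivAt (fun t => -m * t) (-m) t := by
      simpa using (hasDerivAt_id t).const_mul (-m)
    convert! hexp.exp.mul (hF t) using 1; ring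
  have hparts := mul_integral_eq_integral_deriv_mul_add (T := T) hG (by fun_prop)
    (hq.continuousOn_mul (by fun_prop : ContinuousOn (fun s => Real.exp (m * s)) _))
  have hcancel (t : ℝ) :
      Real.exp (-m * t) * F t * (Real.exp (m * t) * q t) = F t * q t := by
    rw [mul_mul_mul_comm, ← Real.exp_add, neg_mul, neg_add_cancel, Real.exp_zero, one_mul]
  simp_rw [hcancel] at hparts
  simp_rw [duhamel_eq m q]
  convert! hparts using 1
  · ring
  · congr 2; ext t; ring

lemma summable_inv_eigenvalue {γ : ℝ} (hγ : 0 < γ) :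
    Summable fun k : ℕ => 1 / ((k * π) ^ 2 + γ) := by
  have hsq : Summable fun k : ℕ => 1 / (k : ℝ) ^ 2 := Real.summable_one_div_nat_pow.2 one_lt_two
  rw [← summable_nat_add_iff 1] at hsq ⊢
  refine Summable.of_nonneg_of_le (fun k => by positivity) (fun k => ?_) hsq
  refine one_div_le_one_div_of_le (by positivity) ?_
  have hk : ((k + 1 : ℕ) : ℝ) ≤ (k + 1 : ℕ) * π :=
    le_mul_of_one_le_right (by positivity) (by linarith [Real.pi_gt_three])
  linarith [pow_le_pow_left₀ (by positivity) hk 2]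

lemma summable_const_div_eigenvalue (C : ℝ) : Summable fun k : ℕ => C / ((k * π) ^ 2 + 1) := by
  simpa only [mul_one_div] using (summable_inv_eigenvalue zero_lt_one).mul_left C

/-! ### Functions on the cylinder -/

section Slices

variable {v : ℝ → ℝ → ℝ}

lemma continuous_slice_fst (hv : Continuous fun p : ℝ × ℝ => v p.1 p.2) (t : ℝ) :
    Continuous fun x => v x t :=
  hv.comp (Continuous.prodMk_left t)

lemma continuous_slice_snd (hv : Continuous fun p : ℝ × ℝ => v p.1 p.2) (x : ℝ) :
    Continuous fun t => v x t :=
  hv.comp (Continuous.prodMk_right x)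

lemma hasDerivAt_fst (hv : ContDiff ℝ 1 (fun p : ℝ × ℝ => v p.1 p.2)) (x t : ℝ) :
    HasDerivAt (fun x => v x t) (fderiv ℝ (fun p : ℝ × ℝ => v p.1 p.2) (x, t) (1, 0)) x :=
  ((hv.differentiable one_ne_zero) (x, t)).hasFDerivAt.comp_hasDerivAt (f := fun x => (x, t)) x
    ((hasDerivAt_id x).prodMk (hasDerivAt_const x t))

lemma hasDerivAt_snd (hv : ContDiff ℝ 1 (fun p : ℝ × ℝ => v p.1 p.2)) (x t : ℝ) :
    HasDerivAt (fun t => v x t) (fderiv ℝ (fun p : ℝ × ℝ => v p.1 p.2) (x, t) (0, 1)) t :=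
  ((hv.differentiable one_ne_zero) (x, t)).hasFDerivAt.comp_hasDerivAt (f := fun t => (x, t)) t
    ((hasDerivAt_const t x).prodMk (hasDerivAt_id t))

lemma hasDerivAt_deriv_fst (hv : ContDiff ℝ 1 (fun p : ℝ × ℝ => v p.1 p.2)) (x t : ℝ) :
    HasDerivAt (fun x => v x t) (deriv (fun x => v x t) x) x :=
  (hasDerivAt_fst hv x t).differentiableAt.hasDerivAt

lemma hasDerivAt_deriv_snd (hv : ContDiff ℝ 1 (fun p : ℝ × ℝ => v p.1 p.2)) (x t : ℝ) :
    HasDerivAt (fun t => v x t) (deriv (fun t => v x t) t) t :=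
  (hasDerivAt_snd hv x t).differentiableAt.hasDerivAt

lemma continuous_deriv_fst (hv : ContDiff ℝ 1 (fun p : ℝ × ℝ => v p.1 p.2)) :
    Continuous fun p : ℝ × ℝ => deriv (fun x => v x p.2) p.1 := by
  simp_rw [fun p : ℝ × ℝ => (hasDerivAt_fst hv p.1 p.2).deriv]
  exact (hv.continuous_fderiv one_ne_zero).clm_apply continuous_const

lemma continuous_deriv_snd (hv : ContDiff ℝ 1 (fun p : ℝ × ℝ => v p.1 p.2)) :
    Continuous fun p : ℝ × ℝ => deriv (fun t => v p.1 t) p.2 := by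
  simp_rw [fun p : ℝ × ℝ => (hasDerivAt_snd hv p.1 p.2).deriv]
  exact (hv.continuous_fderiv one_ne_zero).clm_apply continuous_const

lemma continuous_cosCoeff (hv : Continuous fun p : ℝ × ℝ => v p.1 p.2) (k : ℕ) :
    Continuous fun t => cosCoeff (fun x => v x t) k := by
  refine intervalIntegral.continuous_parametric_intervalIntegral_of_continuous' ?_ 0 1
  exact Continuous.mul (by fun_prop) (hv.comp continuous_swap)

lemma hasDerivAt_cosCoeff (hv : ContDiff ℝ 1 (fun p : ℝ × ℝ => v p.1 p.2)) (k : ℕ) (t : ℝ) :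
    HasDerivAt (fun t => cosCoeff (fun x => v x t) k)
      (cosCoeff (fun x => deriv (fun t => v x t) t) k) t := by
  obtain ⟨C, hC⟩ := (isCompact_Icc.prod isCompact_Icc :
    IsCompact (Icc (0 : ℝ) 1 ×ˢ Icc (t - 1) (t + 1))).exists_bound_of_continuousOn
      (continuous_deriv_snd hv).continuousOn
  have hcont (t : ℝ) : Continuous fun x => Real.cos (k * π * x) * v x t :=
    Continuous.mul (by fun_prop) (continuous_slice_fst hv.continuous t)
  have hcont' : Continuous fun x => Real.cos (k * π * x) * deriv (fun t => v x t) t :=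
    Continuous.mul (by fun_prop)
      (continuous_slice_fst (v := fun x t => deriv (fun t => v x t) t) (continuous_deriv_snd hv) t)
  refine (intervalIntegral.hasDerivAt_integral_of_dominated_loc_of_deriv_le
    (F := fun t x => Real.cos (k * π * x) * v x t)
    (F' := fun t x => Real.cos (k * π * x) * deriv (fun t => v x t) t)
    (bound := fun _ => C) (Icc_mem_nhds (sub_one_lt t) (lt_add_one t))
    (Eventually.of_forall fun t => (hcont t).aestronglyMeasurable)
    ((hcont t).intervalIntegrable _ _) hcont'.aestronglyMeasurable
    (ae_of_all _ fun x hx s hs => ?_) intervalIntegrable_const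
    (ae_of_all _ fun x _ s _ => (hasDerivAt_deriv_snd hv x s).const_mul _)).2
  rw [uIoc_of_le zero_le_one] at hx
  rw [norm_mul, ← one_mul C]
  exact mul_le_mul (Real.abs_cos_le_one _) (hC (x, s) ⟨Ioc_subset_Icc_self hx, hs⟩)
    (norm_nonneg _) zero_le_one

end Slices

section Cylinder

variable {T : ℝ}

lemma restrict_cylinder (T : ℝ) : (volume : Measure (ℝ × ℝ)).restrict (cylinder T)
    = (volume.restrict (Ioo (0 : ℝ) 1)).prod (volume.restrict (Ioo (0 : ℝ) T)) := by
  rw [Measure.prod_restrict, cylinder, Measure.volume_eq_prod]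

lemma measurableSet_cylinder (T : ℝ) : MeasurableSet (cylinder T) :=
  measurableSet_Ioo.prod measurableSet_Ioo

lemma cylinder_subset (T : ℝ) : cylinder T ⊆ Icc (0 : ℝ) 1 ×ˢ Icc (0 : ℝ) T :=
  prod_mono Ioo_subset_Icc_self Ioo_subset_Icc_self

instance isFiniteMeasure_cylinder (T : ℝ) :
    IsFiniteMeasure ((volume : Measure (ℝ × ℝ)).restrict (cylinder T)) := by
  rw [restrict_cylinder]; infer_instance

lemma integral_cylinder (hT : 0 ≤ T) {f : ℝ × ℝ → ℝ}
    (hf : Integrable f (volume.restrict (cylinder T))) :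
    ∫ p in cylinder T, f p = ∫ t in (0 : ℝ)..T, ∫ x in (0 : ℝ)..1, f (x, t) := by
  rw [restrict_cylinder] at hf ⊢
  rw [integral_prod_symm _ hf, intervalIntegral.integral_of_le hT, integral_Ioc_eq_integral_Ioo]
  simp_rw [intervalIntegral.integral_of_le (zero_le_one (α := ℝ)), integral_Ioc_eq_integral_Ioo]

lemma memLp_cylinder {f : ℝ × ℝ → ℝ} (hf : ContinuousOn f (Icc (0 : ℝ) 1 ×ˢ Icc (0 : ℝ) T))
    (r : ENNReal) : MemLp f r (volume.restrict (cylinder T)) := by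
  obtain ⟨C, hC⟩ := (isCompact_Icc.prod isCompact_Icc).exists_bound_of_continuousOn hf
  refine MemLp.of_bound ((hf.mono (cylinder_subset T)).aestronglyMeasurable
    (measurableSet_cylinder T)) C ?_
  exact (ae_restrict_mem (measurableSet_cylinder T)).mono fun p hp => hC p (cylinder_subset T hp)

lemma integrable_cylinder {f : ℝ × ℝ → ℝ}
    (hf : ContinuousOn f (Icc (0 : ℝ) 1 ×ˢ Icc (0 : ℝ) T)) :
    Integrable f (volume.restrict (cylinder T)) :=
  memLp_one_iff_integrable.1 (memLp_cylinder hf 1)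

variable {z : ℝ → ℝ → ℝ}

lemma continuousOn_trace
    (hz : ContinuousOn (fun p : ℝ × ℝ => z p.1 p.2) (Icc (0 : ℝ) 1 ×ˢ Icc (0 : ℝ) T)) :
    ContinuousOn (fun t => z 1 t) (Icc 0 T) :=
  hz.comp (Continuous.prodMk_right (1 : ℝ)).continuousOn
    fun _ ht => ⟨right_mem_Icc.2 zero_le_one, ht⟩

lemma continuousOn_final (hT : 0 ≤ T)
    (hz : ContinuousOn (fun p : ℝ × ℝ => z p.1 p.2) (Icc (0 : ℝ) 1 ×ˢ Icc (0 : ℝ) T)) :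
    ContinuousOn (fun x => z x T) (Icc 0 1) :=
  hz.comp (Continuous.prodMk_left T).continuousOn fun _ hx => ⟨hx, right_mem_Icc.2 hT⟩

end Cylinder

/-! ### Series in `L²` and trigonometric integrals -/

lemma hasSum_integral_mul_of_bounded {ι β : Type*} [Countable ι] [MeasurableSpace β]
    {ρ : Measure β} {F : ι → β → ℝ} (hF : ∀ k, AEStronglyMeasurable (F k) ρ) {B : ι → ℝ}
    (hB : Summable B) (hFB : ∀ k, ∀ᵐ p ∂ρ, |F k p| ≤ B k) {ψ : β → ℝ} (hψ : Integrable ψ ρ) :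
    HasSum (fun k => ∫ p, F k p * ψ p ∂ρ) (∫ p, (∑' k, F k p) * ψ p ∂ρ) := by
  refine hasSum_integral_of_dominated_convergence (fun k p => B k * ‖ψ p‖)
    (fun k => (hF k).mul hψ.aestronglyMeasurable) (fun k => ?_)
    (ae_of_all _ fun p => hB.mul_right _) ?_ ?_
  · filter_upwards [hFB k] with p hp
    rw [norm_mul]
    exact mul_le_mul_of_nonneg_right hp (norm_nonneg _)
  · simpa only [tsum_mul_right] using hψ.norm.const_mul (∑' k, B k)
  · filter_upwards [ae_all_iff.2 hFB] with p hp
    have hsum : Summable fun k => F k p := Summable.of_norm_bounded hB hp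
    exact hsum.hasSum.mul_right (ψ p)

lemma inner_toLp_eq_integral {β : Type*} [MeasurableSpace β] {ρ : Measure β} {f g : β → ℝ}
    (hf : MemLp f 2 ρ) (hg : MemLp g 2 ρ) :
    inner ℝ (hg.toLp g) (hf.toLp f) = ∫ p, f p * g p ∂ρ := by
  rw [L2.inner_def]
  refine integral_congr_ae ?_
  filter_upwards [hf.coeFn_toLp, hg.coeFn_toLp] with p hfp hgp
  simp [hfp, hgp]

theorem exists_memLp_hasSum_integral_mul {ι β : Type*} [MeasurableSpace β] {ρ : Measure β}
    {e : ι → β → ℝ} (he : ∀ k, MemLp (e k) 2 ρ)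
    (horth : ∀ j k, j ≠ k → ∫ p, e j p * e k p ∂ρ = 0)
    (hs : Summable fun k => ∫ p, e k p * e k p ∂ρ) :
    ∃ g : β → ℝ, MemLp g 2 ρ ∧ ∀ ψ : β → ℝ, MemLp ψ 2 ρ →
      HasSum (fun k => ∫ p, e k p * ψ p ∂ρ) (∫ p, g p * ψ p ∂ρ) := by
  set E : ι → Lp ℝ 2 ρ := fun k => (he k).toLp (e k)
  have hfam : OrthogonalFamily ℝ (fun k => Submodule.span ℝ {E k})
      (fun k => (Submodule.span ℝ {E k}).subtypeₗᵢ) := by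
    refine OrthogonalFamily.of_pairwise fun j k hjk => Submodule.isOrtho_span.2 ?_
    rintro _ rfl _ rfl
    rw [inner_toLp_eq_integral]
    exact horth _ _ hjk.symm
  have hsum : Summable E := by
    refine (hfam.summable_iff_norm_sq_summable
      (fun k => ⟨E k, Submodule.mem_span_singleton_self _⟩)).2 (hs.congr fun k => ?_)
    rw [← inner_toLp_eq_integral (he k) (he k), real_inner_self_eq_norm_sq]
    rfl
  refine ⟨_, Lp.memLp (∑' k, E k), fun ψ hψ => ?_⟩
  have hinner := (innerSL ℝ (hψ.toLp ψ)).hasSum hsum.hasSum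
  simp only [innerSL_apply_apply] at hinner
  convert! hinner using 1
  · ext k; rw [inner_toLp_eq_integral]
  · rw [← inner_toLp_eq_integral (Lp.memLp _) hψ, Lp.toLp_coeFn]

lemma hasDerivAt_cos_const_mul (c x : ℝ) :
    HasDerivAt (fun x => Real.cos (c * x)) (-(c * Real.sin (c * x))) x := by
  convert! ((hasDerivAt_id x).const_mul c).cos using 1
  simp only [id_eq]; ring

lemma hasDerivAt_mul_sin_const_mul (c x : ℝ) :
    HasDerivAt (fun x => c * Real.sin (c * x)) (c ^ 2 * Real.cos (c * x)) x := by
  convert! ((hasDerivAt_id x).const_mul c).sin.const_mul c using 1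
  simp only [id_eq]; ring

lemma integral_cos_int_mul_pi {n : ℤ} (hn : n ≠ 0) :
    ∫ x in (0 : ℝ)..1, Real.cos (n * π * x) = 0 := by
  have hc : (n : ℝ) * π ≠ 0 := mul_ne_zero (Int.cast_ne_zero.2 hn) Real.pi_ne_zero
  rw [intervalIntegral.integral_comp_mul_left (fun x => Real.cos x) hc, integral_cos]
  simp [Real.sin_int_mul_pi]

lemma integral_sin_mul_sin {j k : ℕ} (h : j ≠ k) :
    ∫ x in (0 : ℝ)..1, Real.sin (j * π * x) * Real.sin (k * π * x) = 0 := by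
  have hprod (x : ℝ) : Real.sin (j * π * x) * Real.sin (k * π * x)
      = 1 / 2 * Real.cos (((j : ℤ) - k : ℤ) * π * x)
        - 1 / 2 * Real.cos (((j : ℤ) + k : ℤ) * π * x) := by
    push_cast
    rw [sub_mul, sub_mul, add_mul, add_mul, Real.cos_sub, Real.cos_add]; ring
  simp_rw [hprod]
  rw [intervalIntegral.integral_sub (Continuous.intervalIntegrable (by fun_prop) _ _)
    (Continuous.intervalIntegrable (by fun_prop) _ _), intervalIntegral.integral_const_mul,
    intervalIntegral.integral_const_mul, integral_cos_int_mul_pi (by lia),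
    integral_cos_int_mul_pi (by lia), sub_self]

lemma integral_sin_mul_deriv {f f' : ℝ → ℝ} (hf : ∀ x, HasDerivAt f (f' x) x)
    (hf' : Continuous f') (k : ℕ) :
    ∫ x in (0 : ℝ)..1, k * π * Real.sin (k * π * x) * f' x
      = -((k * π) ^ 2 * cosCoeff f k) := by
  rw [intervalIntegral.integral_mul_deriv_eq_deriv_mul
    (fun x _ => hasDerivAt_mul_sin_const_mul (k * π) x) (fun x _ => hf x)
    (Continuous.intervalIntegrable (by fun_prop) _ _) (hf'.intervalIntegrable _ _), cosCoeff,
    ← intervalIntegral.integral_const_mul]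
  simp [Real.sin_nat_mul_pi, mul_assoc]

lemma cosCoeff_deriv {f f' : ℝ → ℝ} (hf : ∀ x, HasDerivAt f (f' x) x)
    (hf' : Continuous f') (h0 : f 0 = 0) (h1 : f 1 = 0) (k : ℕ) :
    cosCoeff f' k = ∫ x in (0 : ℝ)..1, k * π * Real.sin (k * π * x) * f x := by
  rw [cosCoeff, intervalIntegral.integral_mul_deriv_eq_deriv_mul
    (fun x _ => hasDerivAt_cos_const_mul (k * π) x) (fun x _ => hf x)
    (Continuous.intervalIntegrable (by fun_prop) _ _) (hf'.intervalIntegrable _ _)]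
  simp [h0, h1]

/-! ### The Neumann problem -/

/-- The `k`-th time coefficient of the Neumann problem with boundary flux `q`. -/
noncomputable def mode (q : ℝ → ℝ) (k : ℕ) (t : ℝ) : ℝ := duhamel ((k * π) ^ 2) q t

/-- The `k`-th term of the cosine series of `neumannState`. -/
noncomputable def neumannTerm (q : ℝ → ℝ) (k : ℕ) (p : ℝ × ℝ) : ℝ :=
  endWeight k * (Real.cos (k * π * p.1) * mode q k p.2)

/-- The solution of the heat equation with zero initial value, `z_x(0,t) = 0` and
`z_x(1,t) = q(t)`, as a cosine series. -/
noncomputable def neumannState (q : ℝ → ℝ) (x t : ℝ) : ℝ :=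
  ∑' k, neumannTerm q k (x, t)

/-- The `x`-derivative of `neumannTerm`. -/
noncomputable def neumannFlux (q : ℝ → ℝ) (k : ℕ) (p : ℝ × ℝ) : ℝ :=
  -(endWeight k * (k * π * Real.sin (k * π * p.1) * mode q k p.2))

section NeumannState

variable {q : ℝ → ℝ} {C T : ℝ}

lemma abs_mode_le (hC : ∀ t, |q t| ≤ C) {t : ℝ} (ht : t ∈ Icc 0 T) (k : ℕ) :
    |mode q k t| ≤ Real.exp T * C / ((k * π) ^ 2 + 1) :=
  abs_duhamel_le_div_add_one (by positivity) ht hC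

lemma abs_neumannTerm_le (hC : ∀ t, |q t| ≤ C) {p : ℝ × ℝ} (hp : p.2 ∈ Icc 0 T) (k : ℕ) :
    |neumannTerm q k p| ≤ 2 * (Real.exp T * C) / ((k * π) ^ 2 + 1) := by
  rw [neumannTerm, abs_mul, abs_mul, abs_endWeight, mul_div_assoc]
  refine mul_le_mul (cosWeight_le k) ?_ (by positivity) zero_le_two
  exact (mul_le_of_le_one_left (abs_nonneg _) (Real.abs_cos_le_one _)).trans (abs_mode_le hC hp k)

lemma abs_neumannFlux_le (hC : ∀ t, |q t| ≤ C) {p : ℝ × ℝ} (hp : p.2 ∈ Icc 0 T) (k : ℕ) :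
    |neumannFlux q k p| ≤ 2 * (Real.exp T * C) * (k * π / ((k * π) ^ 2 + 1)) := by
  have hkπ : (0 : ℝ) ≤ k * π := by positivity
  have hsin := Real.abs_sin_le_one (k * π * p.1)
  have hweight := cosWeight_le k
  have hmode := abs_mode_le hC hp k
  rw [neumannFlux, abs_neg, abs_mul, abs_mul, abs_mul, abs_of_nonneg hkπ, abs_endWeight]
  calc cosWeight k * (k * π * |Real.sin (k * π * p.1)| * |mode q k p.2|)
      ≤ 2 * (k * π * 1 * (Real.exp T * C / ((k * π) ^ 2 + 1))) := by gcongr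
    _ = 2 * (Real.exp T * C) * (k * π / ((k * π) ^ 2 + 1)) := by ring

lemma continuousOn_neumannState (hq : ∀ a b, IntervalIntegrable q volume a b)
    (hC : ∀ t, |q t| ≤ C) (T : ℝ) :
    ContinuousOn (fun p : ℝ × ℝ => neumannState q p.1 p.2) (univ ×ˢ Icc (0 : ℝ) T) := by
  refine continuousOn_tsum (fun k => Continuous.continuousOn ?_)
    (summable_const_div_eigenvalue (2 * (Real.exp T * C)))
    fun k p hp => abs_neumannTerm_le hC hp.2 k
  have := continuous_duhamel hq ((k * π) ^ 2)
  unfold neumannTerm mode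
  fun_prop

lemma neumannState_one (q : ℝ → ℝ) (t : ℝ) :
    neumannState q 1 t = ∑' k, cosWeight k * mode q k t := by
  refine tsum_congr fun k => ?_
  rw [neumannTerm, mul_one, ← mul_assoc, endWeight_mul_cos]

lemma summable_neumannFlux_bound (D : ℝ) :
    Summable fun k : ℕ => (D * (k * π / ((k * π) ^ 2 + 1))) ^ 2 := by
  refine Summable.of_nonneg_of_le (fun k => sq_nonneg _) (fun k => ?_)
    (summable_const_div_eigenvalue (D ^ 2))
  calc (D * (k * π / ((k * π) ^ 2 + 1))) ^ 2
      = D ^ 2 / ((k * π) ^ 2 + 1) * ((k * π) ^ 2 / ((k * π) ^ 2 + 1)) := by ring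
    _ ≤ D ^ 2 / ((k * π) ^ 2 + 1) := by
        refine mul_le_of_le_one_right (by positivity) ?_
        exact div_le_one_of_le₀ (le_add_of_nonneg_right zero_le_one) (by positivity)

lemma summable_integral_neumannFlux_sq (hC : ∀ t, |q t| ≤ C) :
    Summable fun k => ∫ p in cylinder T, neumannFlux q k p * neumannFlux q k p := by
  refine Summable.of_nonneg_of_le (fun k => integral_nonneg fun p => mul_self_nonneg _)
    (fun k => ?_) ((summable_neumannFlux_bound (2 * (Real.exp T * C))).mul_right
        ((volume.restrict (cylinder T)).real univ))
  refine (Real.le_norm_self _).trans (norm_integral_le_of_norm_le_const ?_)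
  filter_upwards [ae_restrict_mem (measurableSet_cylinder T)] with p hp
  rw [← sq, norm_pow]
  exact pow_le_pow_left₀ (norm_nonneg _) (abs_neumannFlux_le hC (cylinder_subset T hp).2 k) 2

variable (hq : Measurable q) (hC : ∀ t, |q t| ≤ C)
include hq hC

lemma continuous_mode (k : ℕ) : Continuous (mode q k) :=
  continuous_duhamel (intervalIntegrable_of_bounded hq hC) _

lemma continuous_neumannTerm (k : ℕ) : Continuous (neumannTerm q k) := by
  have := continuous_mode hq hC k
  unfold neumannTerm
  fun_prop

lemma continuous_neumannFlux (k : ℕ) : Continuous (neumannFlux q k) := by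
  have := continuous_mode hq hC k
  unfold neumannFlux
  fun_prop

lemma integral_neumannFlux_mul_of_ne (hT : 0 ≤ T) {j k : ℕ} (hjk : j ≠ k) :
    ∫ p in cylinder T, neumannFlux q j p * neumannFlux q k p = 0 := by
  rw [integral_cylinder hT (integrable_cylinder
    ((continuous_neumannFlux hq hC j).fun_mul (continuous_neumannFlux hq hC k)).continuousOn)]
  have hslice (x t : ℝ) : neumannFlux q j (x, t) * neumannFlux q k (x, t)
      = (endWeight j * (j * π * mode q j t) * (endWeight k * (k * π * mode q k t)))
        * (Real.sin (j * π * x) * Real.sin (k * π * x)) := by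
    simp only [neumannFlux]; ring
  simp_rw [hslice, intervalIntegral.integral_const_mul, integral_sin_mul_sin hjk, mul_zero,
    intervalIntegral.integral_zero]

lemma hasSum_integral_neumannState_mul {ψ : ℝ × ℝ → ℝ} (hψ : Continuous ψ) :
    HasSum (fun k => ∫ p in cylinder T, neumannTerm q k p * ψ p)
      (∫ p in cylinder T, neumannState q p.1 p.2 * ψ p) := by
  refine hasSum_integral_mul_of_bounded
    (fun k => (continuous_neumannTerm hq hC k).aestronglyMeasurable)
    (summable_const_div_eigenvalue (2 * (Real.exp T * C))) (fun k => ?_)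
    (integrable_cylinder hψ.continuousOn)
  filter_upwards [ae_restrict_mem (measurableSet_cylinder T)] with p hp
  exact abs_neumannTerm_le hC (cylinder_subset T hp).2 k

lemma hasSum_integral_neumannState_slice {t : ℝ} (ht : 0 ≤ t) {f : ℝ → ℝ}
    (hf : ContinuousOn f (Icc 0 1)) :
    HasSum (fun k => endWeight k * (cosCoeff f k * mode q k t))
      (∫ x in (0 : ℝ)..1, neumannState q x t * f x) := by
  have hterm (k : ℕ) : endWeight k * (cosCoeff f k * mode q k t)
      = ∫ x in Ioc (0 : ℝ) 1, neumannTerm q k (x, t) * f x := by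
    rw [← intervalIntegral.integral_of_le zero_le_one, cosCoeff,
      ← intervalIntegral.integral_mul_const, ← intervalIntegral.integral_const_mul]
    congr 1; ext x; simp only [neumannTerm]; ring
  simp_rw [hterm, intervalIntegral.integral_of_le (zero_le_one (α := ℝ))]
  exact hasSum_integral_mul_of_bounded
    (fun k => ((continuous_neumannTerm hq hC k).comp
      (Continuous.prodMk_left t)).aestronglyMeasurable)
    (summable_const_div_eigenvalue (2 * (Real.exp t * C)))
    (fun k => ae_of_all _ fun x => abs_neumannTerm_le hC ⟨ht, le_rfl⟩ k)
    (hf.integrableOn_Icc.mono_set Ioc_subset_Icc_self)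

lemma integral_neumannTerm_mul (hT : 0 ≤ T) {ψ : ℝ → ℝ → ℝ}
    (hψ : Continuous fun p : ℝ × ℝ => ψ p.1 p.2) (k : ℕ) :
    ∫ p in cylinder T, neumannTerm q k p * ψ p.1 p.2
      = endWeight k * ∫ t in (0 : ℝ)..T, cosCoeff (fun x => ψ x t) k * mode q k t := by
  rw [integral_cylinder hT (integrable_cylinder
    ((continuous_neumannTerm hq hC k).fun_mul hψ).continuousOn),
    ← intervalIntegral.integral_const_mul]
  congr 1; ext t
  rw [cosCoeff, ← intervalIntegral.integral_mul_const, ← intervalIntegral.integral_const_mul]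
  congr 1; ext x; simp only [neumannTerm]; ring

lemma integral_neumannFlux_mul (hT : 0 ≤ T) {ψ : ℝ → ℝ → ℝ}
    (hψ : Continuous fun p : ℝ × ℝ => ψ p.1 p.2) (k : ℕ) :
    ∫ p in cylinder T, neumannFlux q k p * ψ p.1 p.2
      = -(endWeight k * ∫ t in (0 : ℝ)..T,
        (∫ x in (0 : ℝ)..1, k * π * Real.sin (k * π * x) * ψ x t) * mode q k t) := by
  rw [integral_cylinder hT (integrable_cylinder
    ((continuous_neumannFlux hq hC k).fun_mul hψ).continuousOn),
    ← intervalIntegral.integral_const_mul, ← intervalIntegral.integral_neg]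
  congr 1; ext t
  rw [← intervalIntegral.integral_mul_const, ← intervalIntegral.integral_const_mul,
    ← intervalIntegral.integral_neg]
  congr 1; ext x; simp only [neumannFlux]; ring

lemma cosCoeff_integral_mul {v : ℝ → ℝ → ℝ} (hv : Continuous fun p : ℝ × ℝ => v p.1 p.2)
    (k : ℕ) :
    cosCoeff (fun x => ∫ t in (0 : ℝ)..T, q t * v x t) k
      = ∫ t in (0 : ℝ)..T, cosCoeff (fun x => v x t) k * q t := by
  have hcosv : IntegrableOn (fun p : ℝ × ℝ => Real.cos (k * π * p.1) * v p.1 p.2)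
      (uIcc 0 1 ×ˢ uIcc 0 T) :=
    ContinuousOn.integrableOn_compact (isCompact_uIcc.prod isCompact_uIcc)
      (Continuous.continuousOn (by fun_prop))
  have hint := hcosv.bdd_mul (f := fun p : ℝ × ℝ => q p.2) (c := C)
    (hq.comp measurable_snd).aestronglyMeasurable (ae_of_all _ fun p => hC p.2)
  simp_rw [cosCoeff, ← intervalIntegral.integral_const_mul,
    ← intervalIntegral.integral_mul_const]
  rw [intervalIntegral_intervalIntegral_swap]
  · congr 1; ext t; congr 1; ext x; ring
  · refine IntegrableOn.mono_set (hint.congr (ae_of_all _ fun p => ?_))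
      (prod_mono uIoc_subset_uIcc uIoc_subset_uIcc)
    exact mul_left_comm _ _ _

lemma continuousOn_integral_mul {v : ℝ → ℝ → ℝ} (hv : Continuous fun p : ℝ × ℝ => v p.1 p.2) :
    ContinuousOn (fun x => ∫ t in (0 : ℝ)..T, q t * v x t) (Icc 0 1) := by
  obtain ⟨D, hD⟩ := (isCompact_Icc.prod isCompact_uIcc :
    IsCompact (Icc (0 : ℝ) 1 ×ˢ uIcc (0 : ℝ) T)).exists_bound_of_continuousOn hv.continuousOn
  intro x₀ _
  refine intervalIntegral.continuousWithinAt_of_dominated_interval (bound := fun _ => C * D)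
    (Eventually.of_forall fun x => ?_) ?_ intervalIntegrable_const
    (ae_of_all _ fun t _ => (continuous_const.mul (continuous_slice_fst hv t)).continuousWithinAt)
  · exact hq.aestronglyMeasurable.mul (continuous_slice_snd hv x).aestronglyMeasurable
  · filter_upwards [self_mem_nhdsWithin] with x hx
    refine ae_of_all _ fun t ht => ?_
    rw [norm_mul]
    exact mul_le_mul (hC t) (hD (x, t) ⟨hx, uIoc_subset_uIcc ht⟩) (norm_nonneg _)
      ((abs_nonneg _).trans (hC t))

lemma hasSum_endWeight_mul_cosCoeff_integral_mul {v : ℝ → ℝ → ℝ}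
    (hv : Continuous fun p : ℝ × ℝ => v p.1 p.2) {s : ℝ}
    (hs : HasSum (fun k => endWeight k * ∫ t in (0 : ℝ)..T, cosCoeff (fun x => v x t) k * q t) s) :
    s = ∫ t in (0 : ℝ)..T, q t * v 1 t := by
  simp_rw [← cosCoeff_integral_mul hq hC hv] at hs
  have hcoeff : Summable (cosCoeff fun x => ∫ t in (0 : ℝ)..T, q t * v x t) := by
    refine Summable.of_norm_bounded hs.summable.norm fun k => ?_
    rw [norm_mul, Real.norm_eq_abs (endWeight k), abs_endWeight]
    exact le_mul_of_one_le_left (norm_nonneg _) (one_le_cosWeight k)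
  have hone := hasSum_cosCoeff (continuousOn_integral_mul (T := T) hq hC hv) hcoeff
    (right_mem_Icc.2 zero_le_one)
  refine hs.unique (hone.congr_fun ?_)
  intro k
  rw [mul_one, endWeight]; ring

lemma exists_hasSum_neumannFlux (hT : 0 ≤ T) :
    ∃ g : ℝ × ℝ → ℝ, MemLp g 2 (volume.restrict (cylinder T)) ∧
      ∀ ψ : ℝ × ℝ → ℝ, Continuous ψ →
        HasSum (fun k => ∫ p in cylinder T, neumannFlux q k p * ψ p)
          (∫ p in cylinder T, g p * ψ p) := by
  obtain ⟨g, hg, hgs⟩ := exists_memLp_hasSum_integral_mul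
    (fun k => memLp_cylinder (T := T) (continuous_neumannFlux hq hC k).continuousOn 2)
    (fun j k hjk => integral_neumannFlux_mul_of_ne hq hC hT hjk)
    (summable_integral_neumannFlux_sq hC)
  exact ⟨g, hg, fun ψ hψ => hgs ψ (memLp_cylinder hψ.continuousOn 2)⟩

variable {g : ℝ × ℝ → ℝ}

lemma hasWeakDerivX_neumannState (hT : 0 ≤ T) (hg : MemLp g 2 (volume.restrict (cylinder T)))
    (hgs : ∀ ψ : ℝ × ℝ → ℝ, Continuous ψ →
      HasSum (fun k => ∫ p in cylinder T, neumannFlux q k p * ψ p)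
        (∫ p in cylinder T, g p * ψ p)) :
    HasWeakDerivX T (neumannState q) fun x t => g (x, t) := by
  refine ⟨hg, fun η hη _ hsupp => ?_⟩
  have hη0 (x t : ℝ) (h : (x, t) ∉ cylinder T) : η x t = 0 :=
    image_eq_zero_of_notMem_tsupport (f := fun p : ℝ × ℝ => η p.1 p.2) fun h' => h (hsupp h')
  have hηx := continuous_deriv_fst hη
  refine (hasSum_integral_neumannState_mul hq hC hηx).unique ?_
  refine (hgs _ hη.continuous).neg.congr_fun ?_
  intro k
  rw [integral_neumannTerm_mul hq hC hT (ψ := fun x t => deriv (fun x => η x t) x) hηx,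
    integral_neumannFlux_mul hq hC hT hη.continuous, neg_neg]
  congr 2; ext t; congr 1
  exact cosCoeff_deriv (hasDerivAt_deriv_fst hη · t)
    (continuous_slice_fst (v := fun x t => deriv (fun x => η x t) x) hηx t)
    (hη0 0 t fun h => lt_irrefl _ h.1.1) (hη0 1 t fun h => lt_irrefl _ h.1.2) k

lemma cosCoeff_mul_mode {v : ℝ → ℝ → ℝ} (hv : ContDiff ℝ 1 (fun p : ℝ × ℝ => v p.1 p.2))
    (k : ℕ) :
    cosCoeff (fun x => v x T) k * mode q k T
      = (∫ t in (0 : ℝ)..T, cosCoeff (fun x => deriv (fun t => v x t) t) k * mode q k t)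
        + (∫ t in (0 : ℝ)..T, (∫ x in (0 : ℝ)..1,
          k * π * Real.sin (k * π * x) * deriv (fun x => v x t) x) * mode q k t)
        + ∫ t in (0 : ℝ)..T, cosCoeff (fun x => v x t) k * q t := by
  have hvt := continuous_cosCoeff (v := fun x t => deriv (fun t => v x t) t)
    (continuous_deriv_snd hv) k
  have hvc := continuous_cosCoeff hv.continuous k
  have hmode := continuous_mode hq hC k
  have hsin (t : ℝ) := integral_sin_mul_deriv (hasDerivAt_deriv_fst hv · t)
    (continuous_slice_fst (v := fun x t => deriv (fun x => v x t) x) (continuous_deriv_fst hv) t) k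
  simp_rw [hsin]
  rw [← intervalIntegral.integral_add ((hvt.fun_mul hmode).intervalIntegrable _ _)
    (Continuous.intervalIntegrable (by fun_prop) _ _)]
  refine (mul_duhamel_eq (intervalIntegrable_of_bounded hq hC 0 T) _ (hasDerivAt_cosCoeff hv k)
    hvt).trans ?_
  congr 2; ext t; simp only [mode]; ring

lemma neumannState_weak (hT : 0 ≤ T)
    (hgs : ∀ ψ : ℝ × ℝ → ℝ, Continuous ψ →
      HasSum (fun k => ∫ p in cylinder T, neumannFlux q k p * ψ p)
        (∫ p in cylinder T, g p * ψ p))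
    {v : ℝ → ℝ → ℝ} (hv : ContDiff ℝ 1 (fun p : ℝ × ℝ => v p.1 p.2)) :
    (∫ x in (0 : ℝ)..1, neumannState q x T * v x T)
      - (∫ p in cylinder T, neumannState q p.1 p.2 * deriv (fun t => v p.1 t) p.2)
      + (∫ p in cylinder T, g p * deriv (fun x => v x p.2) p.1)
    = ∫ t in (0 : ℝ)..T, q t * v 1 t := by
  have hfinal := hasSum_integral_neumannState_slice hq hC hT
    (continuous_slice_fst hv.continuous T).continuousOn
  have htime := hasSum_integral_neumannState_mul (T := T) hq hC (continuous_deriv_snd hv)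
  have hspace := hgs _ (continuous_deriv_fst hv)
  refine hasSum_endWeight_mul_cosCoeff_integral_mul hq hC hv.continuous
    (((hfinal.sub htime).add hspace).congr_fun ?_)
  intro k
  rw [integral_neumannTerm_mul hq hC hT (ψ := fun x t => deriv (fun t => v x t) t)
      (continuous_deriv_snd hv),
    integral_neumannFlux_mul hq hC hT (ψ := fun x t => deriv (fun x => v x t) x)
      (continuous_deriv_fst hv), cosCoeff_mul_mode hq hC hv]
  ring

theorem isState_neumannState (hT : 0 ≤ T) : IsState T 0 q (neumannState q) := by
  obtain ⟨g, hg, hgs⟩ := exists_hasSum_neumannFlux hq hC hT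
  refine ⟨(continuousOn_neumannState (intervalIntegrable_of_bounded hq hC) hC T).mono
      (prod_mono (subset_univ _) subset_rfl), fun x _ => ?_,
    fun x t => g (x, t), hasWeakDerivX_neumannState hq hC hT hg hgs, fun v hv => ?_⟩
  · simp [neumannState, neumannTerm, mode, duhamel_zero]
  · rw [zero_mul, add_zero]
    exact neumannState_weak hq hC hT hgs hv

end NeumannState

/-! ### The Robin problem -/

lemma exists_tsum_eigenvalue_le {ε : ℝ} (hε : 0 < ε) :
    ∃ γ : ℝ, 0 < γ ∧ ∑' k : ℕ, 1 / ((k * π) ^ 2 + γ) ≤ ε := by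
  have hlim : Tendsto (fun γ : ℝ => ∑' k : ℕ, 1 / ((k * π) ^ 2 + γ)) atTop
      (𝓝 (∑' _ : ℕ, (0 : ℝ))) := by
    refine tendsto_tsum_of_dominated_convergence (summable_inv_eigenvalue zero_lt_one)
      (fun k => ?_) ?_
    · exact tendsto_const_nhds.div_atTop (tendsto_atTop_add_const_left _ _ tendsto_id)
    · filter_upwards [eventually_ge_atTop 1] with γ hγ k
      rw [Real.norm_of_nonneg (by positivity)]
      gcongr
  rw [tsum_zero] at hlim
  obtain ⟨γ, hγε, hγ⟩ := ((hlim.eventually (ge_mem_nhds hε)).and (eventually_gt_atTop 0)).exists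
  exact ⟨γ, hγ, hγε⟩

/-- The trace at `x = 1` of the series solution of `z_t - z_xx + γ z = 0` with zero initial value,
`z_x(0,t) = 0` and `z_x(1,t) = r(t)`. -/
noncomputable def dampedTrace (γ : ℝ) (r : ℝ → ℝ) (t : ℝ) : ℝ :=
  ∑' k, cosWeight k * duhamel ((k * π) ^ 2 + γ) r t

lemma neumannState_one_eq_dampedTrace (γ : ℝ) (q : ℝ → ℝ) (t : ℝ) :
    neumannState q 1 t
      = Real.exp (γ * t) * dampedTrace γ (fun s => Real.exp (-γ * s) * q s) t := by
  rw [neumannState_one, dampedTrace, ← tsum_mul_left]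
  refine tsum_congr fun k => ?_
  rw [mode, duhamel_eq_exp_mul_duhamel_add _ γ, mul_left_comm]

lemma dampedTrace_congr {q r : ℝ → ℝ} {t : ℝ} (ht : 0 ≤ t) (h : ∀ s ∈ Icc 0 t, q s = r s)
    (γ : ℝ) : dampedTrace γ q t = dampedTrace γ r t :=
  tsum_congr fun _ => by rw [duhamel_congr ht h]

section DampedTrace

variable {r : ℝ → ℝ} {R γ : ℝ} (hγ : 0 < γ)
include hγ

lemma abs_weighted_duhamel_le (hR : ∀ t, |r t| ≤ R) {t : ℝ} (ht : 0 ≤ t) (k : ℕ) :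
    |cosWeight k * duhamel ((k * π) ^ 2 + γ) r t| ≤ 2 * R * (1 / ((k * π) ^ 2 + γ)) := by
  rw [abs_mul, abs_of_nonneg (cosWeight_nonneg k), mul_assoc, mul_one_div]
  exact mul_le_mul (cosWeight_le k)
    (abs_duhamel_le (by positivity) ht fun s _ => hR s) (abs_nonneg _) zero_le_two

lemma summable_weighted_duhamel (hR : ∀ t, |r t| ≤ R) {t : ℝ} (ht : 0 ≤ t) :
    Summable fun k : ℕ => cosWeight k * duhamel ((k * π) ^ 2 + γ) r t :=
  Summable.of_norm_bounded ((summable_inv_eigenvalue hγ).mul_left (2 * R))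
    (abs_weighted_duhamel_le hγ hR ht)

lemma abs_dampedTrace_le (hR : ∀ t, |r t| ≤ R) {t : ℝ} (ht : 0 ≤ t) :
    |dampedTrace γ r t| ≤ 2 * R * ∑' k : ℕ, 1 / ((k * π) ^ 2 + γ) := by
  rw [← Real.norm_eq_abs]
  exact tsum_of_norm_bounded ((summable_inv_eigenvalue hγ).hasSum.mul_left (2 * R))
    (abs_weighted_duhamel_le hγ hR ht)

lemma continuous_dampedTrace (hr : Measurable r) (hR : ∀ t, |r t| ≤ R) :
    Continuous fun t => dampedTrace γ r (max t 0) := by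
  refine continuous_tsum (fun k => ?_) ((summable_inv_eigenvalue hγ).mul_left (2 * R))
    fun k t => abs_weighted_duhamel_le hγ hR (le_max_right t 0) k
  have := continuous_duhamel (intervalIntegrable_of_bounded hr hR) ((k * π) ^ 2 + γ)
  fun_prop

lemma dampedTrace_sub {s : ℝ → ℝ} {S : ℝ} (hr : Measurable r) (hR : ∀ t, |r t| ≤ R)
    (hs : Measurable s) (hS : ∀ t, |s t| ≤ S) {t : ℝ} (ht : 0 ≤ t) :
    dampedTrace γ (fun τ => r τ - s τ) t = dampedTrace γ r t - dampedTrace γ s t := by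
  rw [dampedTrace, dampedTrace, dampedTrace, ← (summable_weighted_duhamel hγ hR ht).tsum_sub
    (summable_weighted_duhamel hγ hS ht)]
  refine tsum_congr fun k => ?_
  rw [duhamel_sub (intervalIntegrable_of_bounded hr hR 0 t)
    (intervalIntegrable_of_bounded hs hS 0 t), mul_sub]

end DampedTrace

section Feedback

open BoundedContinuousFunction

variable {H : ℝ → ℝ} {M : ℝ} (hM : ∀ t, |H t| ≤ M) (α : ℝ)
include hM

lemma abs_sub_const_mul_le (f : ℝ →ᵇ ℝ) (s : ℝ) : |H s - α * f s| ≤ M + |α| * ‖f‖ := by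
  refine (abs_sub _ _).trans (add_le_add (hM s) ?_)
  rw [abs_mul]
  exact mul_le_mul_of_nonneg_left (f.norm_coe_le_norm s) (abs_nonneg α)

variable (hH : Measurable H) {γ : ℝ} (hγ : 0 < γ)
include hH hγ

lemma abs_dampedTrace_sub_le
    (hsmall : ∑' k : ℕ, 1 / ((k * π) ^ 2 + γ) ≤ 1 / (4 * (|α| + 1)))
    (f g : ℝ →ᵇ ℝ) {t : ℝ} (ht : 0 ≤ t) :
    |dampedTrace γ (fun s => H s - α * f s) t - dampedTrace γ (fun s => H s - α * g s) t|
      ≤ 1 / 2 * dist f g := by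
  have hmeas (f : ℝ →ᵇ ℝ) : Measurable fun s => H s - α * f s :=
    hH.sub (f.continuous.measurable.const_mul α)
  have hdiff (s : ℝ) : |(H s - α * f s) - (H s - α * g s)| ≤ |α| * dist f g := by
    rw [sub_sub_sub_cancel_left, ← mul_sub, abs_mul, ← Real.dist_eq, dist_comm f g]
    exact mul_le_mul_of_nonneg_left (dist_coe_le_dist s) (abs_nonneg α)
  rw [← dampedTrace_sub hγ (hmeas f) (abs_sub_const_mul_le hM α f) (hmeas g)
    (abs_sub_const_mul_le hM α g) ht]
  calc |dampedTrace γ (fun s => (H s - α * f s) - (H s - α * g s)) t|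
      ≤ 2 * (|α| * dist f g) * ∑' k : ℕ, 1 / ((k * π) ^ 2 + γ) := abs_dampedTrace_le hγ hdiff ht
    _ ≤ 2 * (|α| * dist f g) * (1 / (4 * (|α| + 1))) :=
        mul_le_mul_of_nonneg_left hsmall (by positivity)
    _ = 1 / 2 * (|α| / (|α| + 1) * dist f g) := by field_simp; ring
    _ ≤ 1 / 2 * dist f g := by
        gcongr
        refine mul_le_of_le_one_left dist_nonneg ?_
        rw [div_le_one (by positivity)]
        exact (lt_add_one _).le

theorem exists_eq_dampedTrace_sub_const_mul
    (hsmall : ∑' k : ℕ, 1 / ((k * π) ^ 2 + γ) ≤ 1 / (4 * (|α| + 1))) :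
    ∃ f : ℝ →ᵇ ℝ, ∀ t, 0 ≤ t → f t = dampedTrace γ (fun s => H s - α * f s) t := by
  let Φ : (ℝ →ᵇ ℝ) → (ℝ →ᵇ ℝ) := fun f => ofNormedAddCommGroup
    (fun t => dampedTrace γ (fun s => H s - α * f s) (max t 0))
    (continuous_dampedTrace hγ (hH.sub (f.continuous.measurable.const_mul α))
      (abs_sub_const_mul_le hM α f)) _
    (fun t => abs_dampedTrace_le hγ (abs_sub_const_mul_le hM α f) (le_max_right t 0))
  have hΦ : ContractingWith (1 / 2) Φ := by
    refine ⟨by rw [← NNReal.coe_lt_coe]; norm_num, LipschitzWith.of_dist_le_mul fun f g => ?_⟩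
    refine (dist_le (by positivity)).2 fun t => ?_
    simpa [Φ, Real.dist_eq] using
      abs_dampedTrace_sub_le hM α hH hγ hsmall f g (le_max_right t 0)
  refine ⟨hΦ.fixedPoint Φ, fun t ht => ?_⟩
  conv_lhs => rw [← hΦ.fixedPoint_isFixedPt]
  change dampedTrace γ _ (max t 0) = _
  rw [max_eq_left ht]

end Feedback

theorem exists_neumann_flux {h : ℝ → ℝ} (hh : Measurable h) {M : ℝ} (hM : ∀ t, |h t| ≤ M)
    (α T : ℝ) :
    ∃ q : ℝ → ℝ, Measurable q ∧ (∃ C, ∀ t, |q t| ≤ C) ∧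
      ∀ t ∈ Icc 0 T, q t = h t - α * neumannState q 1 t := by
  obtain ⟨γ, hγ, hsmall⟩ := exists_tsum_eigenvalue_le (ε := 1 / (4 * (|α| + 1))) (by positivity)
  set H : ℝ → ℝ := fun s => Real.exp (-γ * |s|) * h s with hHdef
  have hH : Measurable H := Measurable.mul (by fun_prop) hh
  have hHM (t : ℝ) : |H t| ≤ M := by
    rw [hHdef, abs_mul, abs_of_pos (Real.exp_pos _), ← one_mul M]
    have hexp : -γ * |t| ≤ 0 := by rw [neg_mul, neg_nonpos]; positivity
    exact mul_le_mul (Real.exp_le_one_iff.2 hexp) (hM t) (abs_nonneg _) zero_le_one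
  obtain ⟨f, hf⟩ := exists_eq_dampedTrace_sub_const_mul hHM α hH hγ hsmall
  set q : ℝ → ℝ := (Icc 0 T).indicator fun t => Real.exp (γ * t) * (H t - α * f t) with hqdef
  have hqI : ∀ t ∈ Icc 0 T, q t = Real.exp (γ * t) * (H t - α * f t) :=
    fun t ht => indicator_of_mem ht _
  have hbound (t : ℝ) := abs_sub_const_mul_le hHM α f t
  refine ⟨q, ?_, ⟨Real.exp (γ * T) * (M + |α| * ‖f‖), fun t => ?_⟩, fun t ht => ?_⟩
  · have hfm := f.continuous.measurable
    exact Measurable.indicator (by fun_prop) measurableSet_Icc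
  · by_cases ht : t ∈ Icc 0 T
    · rw [hqI t ht, abs_mul, abs_of_pos (Real.exp_pos _)]
      gcongr
      exacts [ht.2, hbound t]
    · rw [hqdef, indicator_of_notMem ht, abs_zero]
      exact mul_nonneg (Real.exp_pos _).le ((abs_nonneg _).trans (hbound 0))
  · have hfeedback : ∀ s ∈ Icc 0 t, Real.exp (-γ * s) * q s = H s - α * f s := fun s hs => by
      rw [hqI s ⟨hs.1, hs.2.trans ht.2⟩, ← mul_assoc, ← Real.exp_add]
      simp
    have hHt : Real.exp (γ * t) * H t = h t := by
      simp only [hHdef, abs_of_nonneg ht.1]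
      rw [← mul_assoc, ← Real.exp_add]
      simp
    rw [neumannState_one_eq_dampedTrace γ, dampedTrace_congr ht.1 hfeedback, ← hf t ht.1,
      hqI t ht, mul_sub, hHt]
    ring

lemma IsState.robin {T α : ℝ} (hT : 0 ≤ T) {q h : ℝ → ℝ} {z : ℝ → ℝ → ℝ} (hz : IsState T 0 q z)
    (hh : IntervalIntegrable h volume 0 T)
    (hq : ∀ t ∈ Icc 0 T, q t = h t - α * z 1 t) : IsState T α h z := by
  obtain ⟨g, hg, hweak⟩ := hz.weak
  refine ⟨hz.continuousOn, hz.initial, g, hg, fun v hv => ?_⟩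
  have hv1 : ContinuousOn (v 1) (uIcc 0 T) := (continuous_slice_snd hv.continuous 1).continuousOn
  have hz1 : ContinuousOn (z 1) (uIcc 0 T) := by
    rw [uIcc_of_le hT]
    exact continuousOn_trace hz.continuousOn
  have hflux : ∫ t in (0 : ℝ)..T, q t * v 1 t
      = (∫ t in (0 : ℝ)..T, h t * v 1 t) - α * ∫ t in (0 : ℝ)..T, z 1 t * v 1 t := by
    rw [← intervalIntegral.integral_const_mul, ← intervalIntegral.integral_sub
      (hh.mul_continuousOn hv1) ((hz1.fun_mul hv1).intervalIntegrable.const_mul α)]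
    refine intervalIntegral.integral_congr fun t ht => ?_
    rw [uIcc_of_le hT] at ht
    simp only [hq t ht]; ring
  have hneumann := hweak v hv
  rw [hflux] at hneumann
  linarith

/-! ### Test functions without compact support -/

/-- A smooth cutoff for the interval `(0,L)`: it vanishes where `n x (L - x) ≤ 1` and equals one
where `n x (L - x) ≥ 2`. -/
noncomputable def cutoff (L : ℝ) (n : ℕ) (x : ℝ) : ℝ :=
  Real.smoothTransition (n * (x * (L - x)) - 1)

lemma contDiff_cutoff (L : ℝ) (n : ℕ) : ContDiff ℝ 1 (cutoff L n) :=
  Real.smoothTransition.contDiff.comp (by fun_prop)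

lemma abs_cutoff_le (L : ℝ) (n : ℕ) (x : ℝ) : |cutoff L n x| ≤ 1 := by
  rw [cutoff, abs_of_nonneg (Real.smoothTransition.nonneg _)]
  exact Real.smoothTransition.le_one _

lemma tsupport_cutoff_subset {L : ℝ} (hL : 0 ≤ L) (n : ℕ) : tsupport (cutoff L n) ⊆ Ioo 0 L := by
  have hsub : tsupport (cutoff L n) ⊆ {x | 1 ≤ n * (x * (L - x))} := by
    refine closure_minimal (fun x hx => ?_) (isClosed_le (by fun_prop) (by fun_prop))
    by_contra hlt
    rw [mem_ofPred_eq, not_le] at hlt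
    exact hx (Real.smoothTransition.zero_of_nonpos (by linarith))
  refine hsub.trans fun x hx => ?_
  have hpos : 0 < x * (L - x) := pos_of_mul_pos_right (zero_lt_one.trans_le hx) (Nat.cast_nonneg n)
  rcases mul_pos_iff.1 hpos with h | h
  · exact ⟨h.1, by linarith⟩
  · linarith

lemma deriv_smoothTransition_eq_zero {y : ℝ} (hy : y ∉ Icc 0 1) :
    deriv Real.smoothTransition y = 0 := by
  rw [mem_Icc, not_and_or, not_le, not_le] at hy
  rcases hy with h | h
  · have hev : Real.smoothTransition =ᶠ[𝓝 y] fun _ => 0 := by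
      filter_upwards [Iio_mem_nhds h] with z hz
      exact Real.smoothTransition.zero_of_nonpos (le_of_lt hz)
    rw [hev.deriv_eq, deriv_const]
  · have hev : Real.smoothTransition =ᶠ[𝓝 y] fun _ => 1 := by
      filter_upwards [Ioi_mem_nhds h] with z hz
      exact Real.smoothTransition.one_of_one_le (le_of_lt hz)
    rw [hev.deriv_eq, deriv_const]

lemma exists_bound_mul_deriv_smoothTransition :
    ∃ D : ℝ, ∀ y : ℝ, |y * deriv Real.smoothTransition (y - 1)| ≤ D := by
  have : Continuous (deriv Real.smoothTransition) :=
    (Real.smoothTransition.contDiff (n := 1)).continuous_deriv le_rfl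
  have hsupp : HasCompactSupport fun y : ℝ => y * deriv Real.smoothTransition (y - 1) := by
    refine HasCompactSupport.intro (isCompact_Icc (a := (1 : ℝ)) (b := 2)) fun y hy => ?_
    rw [deriv_smoothTransition_eq_zero, mul_zero]
    exact fun h => hy ⟨by linarith [h.1], by linarith [h.2]⟩
  obtain ⟨D, hD⟩ := hsupp.exists_bound_of_continuous (by fun_prop)
  exact ⟨D, hD⟩

lemma deriv_cutoff (L : ℝ) (n : ℕ) (x : ℝ) :
    deriv (cutoff L n) x
      = deriv Real.smoothTransition (n * (x * (L - x)) - 1) * (n * (L - 2 * x)) := by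
  have hS (y : ℝ) : HasDerivAt Real.smoothTransition (deriv Real.smoothTransition y) y :=
    ((Real.smoothTransition.contDiff (n := 1)).differentiable one_ne_zero y).hasDerivAt
  have harg : HasDerivAt (fun x : ℝ => n * (x * (L - x)) - 1) (n * (L - 2 * x)) x := by
    convert! (((hasDerivAt_id x).fun_mul ((hasDerivAt_id x).const_sub L)).const_mul
      (n : ℝ)).sub_const 1 using 1
    simp only [id]; ring
  exact ((hS _).comp x harg).deriv

lemma eventually_cutoff_eq_one {L x : ℝ} (hx : x ∈ Ioo 0 L) :
    ∀ᶠ n : ℕ in atTop, cutoff L n x = 1 ∧ deriv (cutoff L n) x = 0 := by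
  have hpos : 0 < x * (L - x) := mul_pos hx.1 (sub_pos.2 hx.2)
  have hlarge := (tendsto_natCast_atTop_atTop (R := ℝ)).atTop_mul_const hpos
  filter_upwards [hlarge.eventually_gt_atTop 2] with n hn
  refine ⟨Real.smoothTransition.one_of_one_le (by linarith), ?_⟩
  rw [deriv_cutoff, deriv_smoothTransition_eq_zero fun h => by linarith [h.2], zero_mul]

/-- Where a function vanishing at both end points is multiplied by the derivative of the cutoff, the
factor `n` is absorbed by `x (1 - x)`. -/
lemma exists_bound_mul_deriv_cutoff (K : ℝ) :
    ∃ B : ℝ, ∀ (n : ℕ), ∀ x ∈ Icc (0 : ℝ) 1, ∀ c : ℝ, |c| ≤ K * (x * (1 - x)) →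
      |c * deriv (cutoff 1 n) x| ≤ B := by
  obtain ⟨D, hD⟩ := exists_bound_mul_deriv_smoothTransition
  refine ⟨|K| * D, fun n x hx c hc => ?_⟩
  have hρ : 0 ≤ x * (1 - x) := mul_nonneg hx.1 (sub_nonneg.2 hx.2)
  set S' := deriv Real.smoothTransition (n * (x * (1 - x)) - 1)
  have hslope : |1 - 2 * x| ≤ 1 := abs_le.2 ⟨by linarith [hx.2], by linarith [hx.1]⟩
  calc |c * deriv (cutoff 1 n) x| = |c| * |n * S'| * |1 - 2 * x| := by
        rw [deriv_cutoff, ← abs_mul, ← abs_mul]; congr 1; ring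
    _ ≤ |K| * (x * (1 - x)) * |n * S'| * 1 := by
        have := hc.trans (mul_le_mul_of_nonneg_right (le_abs_self K) hρ)
        gcongr
    _ = |K| * |n * (x * (1 - x)) * S'| := by
        rw [show n * (x * (1 - x)) * S' = x * (1 - x) * (n * S') by ring, abs_mul (x * (1 - x)),
          abs_of_nonneg hρ]
        ring
    _ ≤ |K| * D := mul_le_mul_of_nonneg_left (hD _) (abs_nonneg K)

lemma abs_le_mul_of_eq_zero_of_eq_zero {ζ : ℝ → ℝ} {K : ℝ} (hζ : Differentiable ℝ ζ)
    (hK : ∀ x ∈ Icc (0 : ℝ) 1, ‖deriv ζ x‖ ≤ K) (h0 : ζ 0 = 0) (h1 : ζ 1 = 0) {x : ℝ}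
    (hx : x ∈ Icc (0 : ℝ) 1) : |ζ x| ≤ 2 * K * (x * (1 - x)) := by
  have hlip : ∀ y ∈ Icc (0 : ℝ) 1, |ζ x - ζ y| ≤ K * |x - y| := fun y hy =>
    (convex_Icc (0 : ℝ) 1).norm_image_sub_le_of_norm_hasDerivWithin_le
      (fun z _ => (hζ z).hasDerivAt.hasDerivWithinAt) hK hy hx
  have hleft : |ζ x| ≤ K * x := by
    simpa [h0, abs_of_nonneg hx.1] using hlip 0 (by simp)
  have hright : |ζ x| ≤ K * (1 - x) := by
    simpa [h1, abs_sub_comm x 1, abs_of_nonneg (sub_nonneg.2 hx.2)] using hlip 1 (by simp)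
  nlinarith [mul_le_mul_of_nonneg_left hleft (sub_nonneg.2 hx.2),
    mul_le_mul_of_nonneg_left hright hx.1]

lemma tendsto_integral_mul_of_bounded {β : Type*} [MeasurableSpace β] {ρ : Measure β} {f : β → ℝ}
    (hf : Integrable f ρ) {F : ℕ → β → ℝ} {G : β → ℝ} (hF : ∀ n, AEStronglyMeasurable (F n) ρ)
    {B : ℝ} (hB : ∀ n, ∀ᵐ p ∂ρ, |F n p| ≤ B)
    (hlim : ∀ᵐ p ∂ρ, Tendsto (fun n => F n p) atTop (𝓝 (G p))) :
    Tendsto (fun n => ∫ p, f p * F n p ∂ρ) atTop (𝓝 (∫ p, f p * G p ∂ρ)) := by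
  refine tendsto_integral_of_dominated_convergence (fun p => |f p| * B)
    (fun n => hf.aestronglyMeasurable.mul (hF n)) (hf.abs.mul_const _) (fun n => ?_) ?_
  · filter_upwards [hB n] with p hp
    rw [norm_mul]
    exact mul_le_mul_of_nonneg_left hp (norm_nonneg _)
  · filter_upwards [hlim] with p hp
    exact hp.const_mul _

section Truncation

variable {T : ℝ} {η : ℝ → ℝ → ℝ}

/-- Multiplication by cutoffs in both variables turns `η` into a test function compactly supported
in the cylinder. -/
noncomputable def truncate (T : ℝ) (η : ℝ → ℝ → ℝ) (n : ℕ) (x t : ℝ) : ℝ :=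
  η x t * (cutoff 1 n x * cutoff T n t)

lemma abs_truncate_le (n : ℕ) (x t : ℝ) : |truncate T η n x t| ≤ |η x t| := by
  rw [truncate, abs_mul, abs_mul]
  exact mul_le_of_le_one_right (abs_nonneg _)
    (mul_le_one₀ (abs_cutoff_le 1 n x) (abs_nonneg _) (abs_cutoff_le T n t))

variable (hη : ContDiff ℝ 1 fun p : ℝ × ℝ => η p.1 p.2)
include hη

lemma contDiff_truncate (n : ℕ) : ContDiff ℝ 1 fun p : ℝ × ℝ => truncate T η n p.1 p.2 :=
  hη.mul (((contDiff_cutoff 1 n).comp contDiff_fst).mul ((contDiff_cutoff T n).comp contDiff_snd))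

lemma deriv_truncate (n : ℕ) (x t : ℝ) :
    deriv (fun x => truncate T η n x t) x
      = (deriv (fun x => η x t) x * cutoff 1 n x + η x t * deriv (cutoff 1 n) x)
        * cutoff T n t := by
  have hcut : HasDerivAt (cutoff 1 n) (deriv (cutoff 1 n) x) x :=
    ((contDiff_cutoff 1 n).differentiable one_ne_zero x).hasDerivAt
  simp only [truncate, ← mul_assoc]
  exact (((hasDerivAt_deriv_fst hη x t).fun_mul hcut).mul_const _).deriv

omit hη in
lemma tsupport_truncate_subset (T : ℝ) (η : ℝ → ℝ → ℝ) (n : ℕ) :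
    tsupport (fun p : ℝ × ℝ => truncate T η n p.1 p.2)
      ⊆ tsupport (cutoff 1 n) ×ˢ tsupport (cutoff T n) := by
  refine closure_minimal (fun p hp => ?_) ((isClosed_tsupport _).prod (isClosed_tsupport _))
  have hne := right_ne_zero_of_mul (Function.mem_support.1 hp)
  exact ⟨subset_tsupport _ (left_ne_zero_of_mul hne), subset_tsupport _ (right_ne_zero_of_mul hne)⟩

lemma HasWeakDerivX.integral_truncate (hT : 0 ≤ T) {φ g : ℝ → ℝ → ℝ} (hg : HasWeakDerivX T φ g)
    (n : ℕ) :
    ∫ p in cylinder T, φ p.1 p.2 * deriv (fun x => truncate T η n x p.2) p.1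
      = -∫ p in cylinder T, g p.1 p.2 * truncate T η n p.1 p.2 := by
  have hsupp : tsupport (fun p : ℝ × ℝ => truncate T η n p.1 p.2) ⊆ cylinder T :=
    (tsupport_truncate_subset T η n).trans
      (prod_mono (tsupport_cutoff_subset zero_le_one n) (tsupport_cutoff_subset hT n))
  refine hg.2 _ (contDiff_truncate hη n) ?_ hsupp
  exact (isCompact_Icc.prod isCompact_Icc).of_isClosed_subset (isClosed_tsupport _)
    (hsupp.trans (cylinder_subset T))

lemma exists_bound_deriv_truncate (hη0 : ∀ t, η 0 t = 0) (hη1 : ∀ t, η 1 t = 0) :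
    ∃ B : ℝ, ∀ n, ∀ p ∈ cylinder T, |deriv (fun x => truncate T η n x p.2) p.1| ≤ B := by
  obtain ⟨K, hK⟩ := (isCompact_Icc.prod isCompact_Icc :
    IsCompact (Icc (0 : ℝ) 1 ×ˢ Icc (0 : ℝ) T)).exists_bound_of_continuousOn
      (continuous_deriv_fst hη).continuousOn
  obtain ⟨B, hB⟩ := exists_bound_mul_deriv_cutoff (2 * K)
  refine ⟨K + B, fun n p hp => ?_⟩
  obtain ⟨hx, ht⟩ := cylinder_subset T hp
  have hη' : |η p.1 p.2| ≤ 2 * K * (p.1 * (1 - p.1)) :=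
    abs_le_mul_of_eq_zero_of_eq_zero
      (fun x => (hasDerivAt_deriv_fst hη x p.2).differentiableAt)
      (fun x hx => hK (x, p.2) ⟨hx, ht⟩) (hη0 _) (hη1 _) hx
  have hinner : |deriv (fun x => η x p.2) p.1 * cutoff 1 n p.1| ≤ K := by
    rw [abs_mul]
    exact (mul_le_of_le_one_right (abs_nonneg _) (abs_cutoff_le 1 n p.1)).trans (hK p ⟨hx, ht⟩)
  rw [deriv_truncate hη, abs_mul]
  exact (mul_le_of_le_one_right (abs_nonneg _) (abs_cutoff_le T n p.2)).trans
    ((abs_add_le _ _).trans (add_le_add hinner (hB n _ hx _ hη')))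

theorem HasWeakDerivX.integral_mul_deriv (hT : 0 ≤ T) {φ g : ℝ → ℝ → ℝ}
    (hg : HasWeakDerivX T φ g)
    (hφ : Integrable (fun p : ℝ × ℝ => φ p.1 p.2) (volume.restrict (cylinder T)))
    (hη0 : ∀ t, η 0 t = 0) (hη1 : ∀ t, η 1 t = 0) :
    ∫ p in cylinder T, φ p.1 p.2 * deriv (fun x => η x p.2) p.1
      = -∫ p in cylinder T, g p.1 p.2 * η p.1 p.2 := by
  obtain ⟨B, hB⟩ := exists_bound_deriv_truncate (T := T) hη hη0 hη1
  obtain ⟨K, hK⟩ := (isCompact_Icc.prod isCompact_Icc :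
    IsCompact (Icc (0 : ℝ) 1 ×ˢ Icc (0 : ℝ) T)).exists_bound_of_continuousOn
      hη.continuous.continuousOn
  have hQ := ae_restrict_mem (μ := volume) (measurableSet_cylinder T)
  have hleft := tendsto_integral_mul_of_bounded hφ
    (F := fun n p => deriv (fun x => truncate T η n x p.2) p.1)
    (G := fun p => deriv (fun x => η x p.2) p.1)
    (fun n => (continuous_deriv_fst (contDiff_truncate hη n)).aestronglyMeasurable)
    (fun n => hQ.mono (hB n)) (hQ.mono fun p hp => tendsto_const_nhds.congr' ?_)
  · have hright := tendsto_integral_mul_of_bounded (hg.1.integrable one_le_two)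
      (F := fun n p => truncate T η n p.1 p.2) (G := fun p => η p.1 p.2)
      (fun n => (contDiff_truncate hη n).continuous.aestronglyMeasurable)
      (fun n => hQ.mono fun p hp => (abs_truncate_le n p.1 p.2).trans (hK p (cylinder_subset T hp)))
      (hQ.mono fun p hp => tendsto_const_nhds.congr' ?_)
    · refine tendsto_nhds_unique (hleft.congr fun n => ?_) hright.neg
      exact hg.integral_truncate hη hT n
    · filter_upwards [eventually_cutoff_eq_one hp.1, eventually_cutoff_eq_one hp.2] with n hx ht
      rw [truncate, hx.1, ht.1, mul_one, mul_one]
  · filter_upwards [eventually_cutoff_eq_one hp.1, eventually_cutoff_eq_one hp.2] with n hx ht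
    rw [deriv_truncate hη, hx.1, hx.2, ht.1, mul_zero, add_zero, mul_one, mul_one]

end Truncation

/-! ### The adjoint state and duality -/

lemma IsAdjointState.congr {T α : ℝ} (hT : 0 ≤ T) {d : ℝ → ℝ} {φ ψ : ℝ → ℝ → ℝ}
    (hφ : IsAdjointState T α d φ)
    (h : ∀ x ∈ Icc (0 : ℝ) 1, ∀ t ∈ Icc (0 : ℝ) T, φ x t = ψ x t) : IsAdjointState T α d ψ := by
  obtain ⟨g, ⟨hg, hgw⟩, hw⟩ := hφ.weak
  have hQ (f : ℝ × ℝ → ℝ) :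
      ∫ p in cylinder T, ψ p.1 p.2 * f p = ∫ p in cylinder T, φ p.1 p.2 * f p :=
    setIntegral_congr_fun (measurableSet_cylinder T) fun p hp => by
      obtain ⟨hx, ht⟩ := cylinder_subset T hp
      simp only [h p.1 hx p.2 ht]
  have hinit (v : ℝ → ℝ) : ∫ x in (0 : ℝ)..1, ψ x 0 * v x = ∫ x in (0 : ℝ)..1, φ x 0 * v x :=
    intervalIntegral.integral_congr fun x hx => by
      rw [uIcc_of_le zero_le_one] at hx
      simp only [h x hx 0 ⟨le_rfl, hT⟩]
  have htrace (v : ℝ → ℝ) : ∫ t in (0 : ℝ)..T, ψ 1 t * v t = ∫ t in (0 : ℝ)..T, φ 1 t * v t :=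
    intervalIntegral.integral_congr fun t ht => by
      rw [uIcc_of_le hT] at ht
      simp only [h 1 (right_mem_Icc.2 zero_le_one) t ht]
  refine ⟨hφ.continuousOn.congr fun p hp => (h p.1 hp.1 p.2 hp.2).symm,
    fun x hx => by rw [← h x hx T ⟨hT, le_rfl⟩, hφ.terminal x hx], g,
    ⟨hg, fun η hη hcomp hsupp => (hQ _).trans (hgw η hη hcomp hsupp)⟩, fun v hv => ?_⟩
  rw [← hw v hv, hQ, hinit, htrace]

/-- The du Bois-Reymond lemma for `-f' + R = 0` with terminal value `f T = B`. -/
lemma eq_add_integral_of_forall_contDiff {f R : ℝ → ℝ} {T B : ℝ} (hT : 0 < T) (hf : Continuous f)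
    (hR : Continuous R)
    (h : ∀ θ : ℝ → ℝ, ContDiff ℝ 1 θ → θ 0 = 0 →
      (∫ t in (0 : ℝ)..T, f t * deriv θ t) + ∫ t in (0 : ℝ)..T, R t * θ t = B * θ T)
    {t : ℝ} (ht : t ∈ Icc 0 T) : f t = B + ∫ s in T..t, R s := by
  set I : ℝ → ℝ := fun t => ∫ s in T..t, R s
  have hIderiv (t : ℝ) : HasDerivAt I (R t) t := (hR.integral_hasStrictDerivAt T t).hasDerivAt
  have hIcont : Continuous I := continuous_iff_continuousAt.2 fun t => (hIderiv t).continuousAt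
  set F : ℝ → ℝ := fun t => f t - I t - B with hF
  have hFcont : Continuous F := by fun_prop
  set θ : ℝ → ℝ := fun t => ∫ s in (0 : ℝ)..t, F s
  have hθderiv (t : ℝ) : HasDerivAt θ (F t) t := (hFcont.integral_hasStrictDerivAt 0 t).hasDerivAt
  have hderiv : deriv θ = F := funext fun t => (hθderiv t).deriv
  have hθdiff : ContDiff ℝ 1 θ :=
    contDiff_one_iff_deriv.2 ⟨fun t => (hθderiv t).differentiableAt, hderiv ▸ hFcont⟩
  have hθ0 : θ 0 = 0 := intervalIntegral.integral_same
  have hweak := h θ hθdiff hθ0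
  have hint {g : ℝ → ℝ} (hg : Continuous g) : IntervalIntegrable g volume 0 T :=
    hg.intervalIntegrable _ _
  have hparts := intervalIntegral.integral_deriv_mul_eq_sub (a := 0) (b := T)
    (fun t _ => hIderiv t) (fun t _ => hθderiv t) (hint hR) (hint hFcont)
  rw [intervalIntegral.integral_add (hint (hR.fun_mul hθdiff.continuous))
    (hint (hIcont.fun_mul hFcont)), hθ0, show I T = 0 from intervalIntegral.integral_same,
    zero_mul, mul_zero, sub_zero] at hparts
  have hzero : ∫ t in (0 : ℝ)..T, F t * F t = 0 := by
    calc ∫ t in (0 : ℝ)..T, F t * F t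
        = ∫ t in (0 : ℝ)..T, (f t * F t - I t * F t - B * F t) :=
          intervalIntegral.integral_congr fun t _ => by simp only [hF]; ring
      _ = (∫ t in (0 : ℝ)..T, f t * F t) - (∫ t in (0 : ℝ)..T, I t * F t) - B * θ T := by
          rw [intervalIntegral.integral_sub (hint (by fun_prop)) (hint (by fun_prop)),
            intervalIntegral.integral_sub (hint (by fun_prop)) (hint (by fun_prop)),
            intervalIntegral.integral_const_mul]
      _ = 0 := by rw [hderiv] at hweak; linarith
  have hFt : F t = 0 := by
    by_contra hne
    exact (intervalIntegral.integral_pos hT (hFcont.fun_mul hFcont).continuousOn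
      (fun s _ => mul_self_nonneg (F s)) ⟨t, ht, mul_self_pos.2 hne⟩).ne' hzero
  linarith [show f t - I t - B = 0 from hFt]

section Duality

variable {T α : ℝ} {d : ℝ → ℝ} {φ : ℝ → ℝ → ℝ}

/-- The time derivative of the `k`-th cosine coefficient of the adjoint state. -/
noncomputable def adjointRate (α : ℝ) (φ : ℝ → ℝ → ℝ) (k : ℕ) (t : ℝ) : ℝ :=
  (k * π) ^ 2 * cosCoeff (fun x => φ x t) k + α * Real.cos (k * π) * φ 1 t

lemma integral_mul_cos_mul (f : ℝ → ℝ) (k : ℕ) (c : ℝ) :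
    ∫ x in (0 : ℝ)..1, f x * (Real.cos (k * π * x) * c) = cosCoeff f k * c := by
  rw [cosCoeff, ← intervalIntegral.integral_mul_const]
  exact intervalIntegral.integral_congr fun x _ => by ring

lemma integral_cylinder_mul_cos (hT : 0 ≤ T) (hc : Continuous fun p : ℝ × ℝ => φ p.1 p.2)
    (k : ℕ) {f : ℝ → ℝ} (hf : Continuous f) :
    ∫ p in cylinder T, φ p.1 p.2 * (Real.cos (k * π * p.1) * f p.2)
      = ∫ t in (0 : ℝ)..T, cosCoeff (fun x => φ x t) k * f t := by
  rw [integral_cylinder hT (integrable_cylinder (Continuous.continuousOn (by fun_prop)))]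
  simp only [integral_mul_cos_mul]

variable (hT : 0 < T) (hφ : IsAdjointState T α d φ) (hc : Continuous fun p : ℝ × ℝ => φ p.1 p.2)

include hc in
lemma continuous_adjointRate (k : ℕ) : Continuous (adjointRate α φ k) := by
  have := continuous_cosCoeff hc k
  have := continuous_slice_snd hc 1
  unfold adjointRate
  fun_prop

include hc in
lemma integral_adjointRate_mul (k : ℕ) {θ : ℝ → ℝ} (hθ : Continuous θ) :
    ∫ t in (0 : ℝ)..T, adjointRate α φ k t * θ t
      = (k * π) ^ 2 * (∫ t in (0 : ℝ)..T, cosCoeff (fun x => φ x t) k * θ t)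
        + α * ∫ t in (0 : ℝ)..T, φ 1 t * (Real.cos (k * π * 1) * θ t) := by
  have := continuous_cosCoeff hc k
  have := continuous_slice_snd hc 1
  rw [← intervalIntegral.integral_const_mul, ← intervalIntegral.integral_const_mul,
    ← intervalIntegral.integral_add (Continuous.intervalIntegrable (by fun_prop) _ _)
      (Continuous.intervalIntegrable (by fun_prop) _ _)]
  exact intervalIntegral.integral_congr fun t _ => by simp only [adjointRate, mul_one]; ring

include hc in
lemma HasWeakDerivX.integral_mul_deriv_cos (hT : 0 ≤ T) {g : ℝ → ℝ → ℝ} (hg : HasWeakDerivX T φ g)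
    (k : ℕ) {θ : ℝ → ℝ} (hθ : ContDiff ℝ 1 θ) :
    ∫ p in cylinder T, g p.1 p.2 * deriv (fun x => Real.cos (k * π * x) * θ p.2) p.1
      = (k * π) ^ 2 * ∫ t in (0 : ℝ)..T, cosCoeff (fun x => φ x t) k * θ t := by
  have hcos (x t : ℝ) : deriv (fun x => Real.cos (k * π * x) * θ t) x
      = -(k * π * Real.sin (k * π * x) * θ t) := by
    rw [((hasDerivAt_cos_const_mul (k * π) x).mul_const (θ t)).deriv, neg_mul]
  have hsin (x t : ℝ) : deriv (fun x => k * π * Real.sin (k * π * x) * θ t) x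
      = (k * π) ^ 2 * (Real.cos (k * π * x) * θ t) := by
    rw [((hasDerivAt_mul_sin_const_mul (k * π) x).mul_const (θ t)).deriv, mul_assoc]
  have hparts := HasWeakDerivX.integral_mul_deriv
    (η := fun x t => k * π * Real.sin (k * π * x) * θ t) (by fun_prop) hT hg
    (integrable_cylinder hc.continuousOn) (by simp) (by simp [Real.sin_nat_mul_pi])
  simp_rw [hsin, mul_left_comm _ (((k : ℝ) * π) ^ 2), integral_const_mul] at hparts
  simp_rw [hcos, mul_neg, integral_neg]
  rw [← hparts, integral_cylinder_mul_cos hT hc k hθ.continuous]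

include hT hφ hc

lemma IsAdjointState.cosCoeff_eq (k : ℕ) {t : ℝ} (ht : t ∈ Icc 0 T) :
    cosCoeff (fun x => φ x t) k = cosCoeff d k + ∫ s in T..t, adjointRate α φ k s := by
  refine eq_add_integral_of_forall_contDiff hT (continuous_cosCoeff hc k)
    (continuous_adjointRate hc k) (fun θ hθ hθ0 => ?_) ht
  obtain ⟨g, hg, hweak⟩ := hφ.weak
  have htest := hweak (fun x t => Real.cos (k * π * x) * θ t) (by fun_prop)
  have hderiv (x t : ℝ) : deriv (fun t => Real.cos (k * π * x) * θ t) t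
      = Real.cos (k * π * x) * deriv θ t :=
    deriv_const_mul _ (hθ.differentiable one_ne_zero t)
  simp_rw [hderiv] at htest
  rw [integral_mul_cos_mul, integral_mul_cos_mul,
    integral_cylinder_mul_cos hT.le hc k (hθ.continuous_deriv le_rfl),
    hg.integral_mul_deriv_cos hc hT.le k hθ, hθ0, mul_zero, zero_add] at htest
  rw [integral_adjointRate_mul hc k hθ.continuous, ← htest, add_assoc]

lemma IsAdjointState.cosCoeff_mul_mode {q : ℝ → ℝ} (hq : IntervalIntegrable q volume 0 T) (k : ℕ) :
    cosCoeff d k * mode q k T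
      = α * Real.cos (k * π) * (∫ t in (0 : ℝ)..T, mode q k t * φ 1 t)
        + ∫ t in (0 : ℝ)..T, cosCoeff (fun x => φ x t) k * q t := by
  have hrate := continuous_adjointRate (α := α) hc k
  have hparts := mul_duhamel_eq hq ((k * π) ^ 2)
    (F := fun t => cosCoeff d k + ∫ s in T..t, adjointRate α φ k s)
    (fun t => (hrate.integral_hasStrictDerivAt T t).hasDerivAt.const_add _) hrate
  rw [intervalIntegral.integral_same, add_zero] at hparts
  rw [mode, hparts, ← intervalIntegral.integral_const_mul]
  congr 1
  · refine intervalIntegral.integral_congr fun t ht => ?_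
    rw [uIcc_of_le hT.le] at ht
    simp only [← hφ.cosCoeff_eq hT hc k ht]
    simp only [adjointRate, mode]
    ring
  · refine intervalIntegral.integral_congr fun t ht => ?_
    rw [uIcc_of_le hT.le] at ht
    simp only [← hφ.cosCoeff_eq hT hc k ht]

end Duality

lemma hasSum_integral_neumannState_one_mul {q : ℝ → ℝ} {C T : ℝ} (hq : Measurable q)
    (hC : ∀ t, |q t| ≤ C) (hT : 0 ≤ T) {f : ℝ → ℝ} (hf : IntervalIntegrable f volume 0 T) :
    HasSum (fun k => cosWeight k * ∫ t in (0 : ℝ)..T, mode q k t * f t)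
      (∫ t in (0 : ℝ)..T, neumannState q 1 t * f t) := by
  simp_rw [← intervalIntegral.integral_const_mul, ← mul_assoc, neumannState_one,
    intervalIntegral.integral_of_le hT]
  refine hasSum_integral_mul_of_bounded
    (fun k => ((continuous_mode hq hC k).const_mul _).aestronglyMeasurable)
    (summable_const_div_eigenvalue (2 * (Real.exp T * C))) (fun k => ?_)
    ((intervalIntegrable_iff_integrableOn_Ioc_of_le hT).1 hf)
  filter_upwards [ae_restrict_mem measurableSet_Ioc] with t ht
  rw [abs_mul, abs_of_nonneg (cosWeight_nonneg k), mul_div_assoc]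
  exact mul_le_mul (cosWeight_le k) (abs_mode_le hC (Ioc_subset_Icc_self ht) k) (abs_nonneg _)
    zero_le_two

theorem IsAdjointState.duality_of_continuous {T α : ℝ} (hT : 0 < T) {d : ℝ → ℝ} {φ : ℝ → ℝ → ℝ}
    (hφ : IsAdjointState T α d φ) (hc : Continuous fun p : ℝ × ℝ => φ p.1 p.2) {q : ℝ → ℝ}
    (hq : Measurable q) {C : ℝ} (hC : ∀ t, |q t| ≤ C) :
    ∫ x in (0 : ℝ)..1, neumannState q x T * d x
      = α * (∫ t in (0 : ℝ)..T, neumannState q 1 t * φ 1 t) + ∫ t in (0 : ℝ)..T, q t * φ 1 t := by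
  have hd : ContinuousOn d (Icc 0 1) :=
    (continuous_slice_fst hc T).continuousOn.congr fun x hx => (hφ.terminal x hx).symm
  have hfinal := hasSum_integral_neumannState_slice hq hC hT.le hd
  have htrace := (hasSum_integral_neumannState_one_mul hq hC hT.le
    ((continuous_slice_snd hc 1).intervalIntegrable 0 T)).mul_left α
  refine sub_eq_iff_eq_add'.1 (hasSum_endWeight_mul_cosCoeff_integral_mul hq hC hc
    ((hfinal.sub htrace).congr_fun ?_))
  intro k
  rw [hφ.cosCoeff_mul_mode hT hc (intervalIntegrable_of_bounded hq hC 0 T), ← endWeight_mul_cos]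
  ring

lemma IsAdjointState.exists_continuous {T α : ℝ} (hT : 0 ≤ T) {d : ℝ → ℝ} {φ : ℝ → ℝ → ℝ}
    (hφ : IsAdjointState T α d φ) :
    ∃ ψ : ℝ → ℝ → ℝ, IsAdjointState T α d ψ ∧ Continuous (fun p : ℝ × ℝ => ψ p.1 p.2) ∧
      ∀ t ∈ Icc 0 T, ψ 1 t = φ 1 t := by
  let ψ : ℝ → ℝ → ℝ := fun x t => φ (projIcc 0 1 zero_le_one x) (projIcc 0 T hT t)
  have heq : ∀ x ∈ Icc (0 : ℝ) 1, ∀ t ∈ Icc (0 : ℝ) T, φ x t = ψ x t := fun x hx t ht => by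
    simp only [ψ, projIcc_of_mem _ hx, projIcc_of_mem _ ht]
  refine ⟨ψ, hφ.congr hT heq, ?_, fun t ht => (heq 1 (right_mem_Icc.2 zero_le_one) t ht).symm⟩
  have hproj : Continuous fun p : ℝ × ℝ =>
      ((projIcc 0 1 zero_le_one p.1 : ℝ), (projIcc 0 T hT p.2 : ℝ)) := by fun_prop
  exact hφ.continuousOn.comp_continuous hproj fun p =>
    ⟨Subtype.coe_prop _, Subtype.coe_prop _⟩

theorem IsAdjointState.exists_state_duality_of_bounded {T α : ℝ} (hT : 0 < T) {d : ℝ → ℝ}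
    {φ : ℝ → ℝ → ℝ} (hφ : IsAdjointState T α d φ) {h : ℝ → ℝ} (hh : Measurable h) {M : ℝ}
    (hM : ∀ t, |h t| ≤ M) :
    ∃ z : ℝ → ℝ → ℝ, IsState T α h z ∧
      ∫ x in (0 : ℝ)..1, d x * z x T = ∫ t in (0 : ℝ)..T, φ 1 t * h t := by
  obtain ⟨q, hq, ⟨C, hC⟩, hqz⟩ := exists_neumann_flux hh hM α T
  have hz := isState_neumannState hq hC hT.le
  refine ⟨neumannState q, hz.robin hT.le (intervalIntegrable_of_bounded hh hM _ _) hqz, ?_⟩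
  obtain ⟨ψ, hψ, hψc, htrace⟩ := hφ.exists_continuous hT.le
  have hψ1 : Continuous (ψ 1) := continuous_slice_snd hψc 1
  have hz1 : ContinuousOn (neumannState q 1) (uIcc 0 T) := by
    rw [uIcc_of_le hT.le]
    exact continuousOn_trace hz.continuousOn
  simp_rw [mul_comm (d _)]
  rw [hψ.duality_of_continuous hT hψc hq hC, ← intervalIntegral.integral_const_mul,
    ← intervalIntegral.integral_add
      ((hz1.fun_mul hψ1.continuousOn).intervalIntegrable.const_mul α)
      ((intervalIntegrable_of_bounded hq hC 0 T).mul_continuousOn hψ1.continuousOn)]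
  refine intervalIntegral.integral_congr fun t ht => ?_
  rw [uIcc_of_le hT.le] at ht
  simp only [hqz t ht, htrace t ht]
  ring

lemma exists_measurable_bounded_ae_eq {β : Type*} [MeasurableSpace β] {ρ : Measure β} {h : β → ℝ}
    (hh : MemLp h ⊤ ρ) :
    ∃ h' : β → ℝ, Measurable h' ∧ (∃ M, ∀ t, |h' t| ≤ M) ∧ h' =ᵐ[ρ] h := by
  set M := lpNorm h ⊤ ρ
  have hM : 0 ≤ M := lpNorm_nonneg
  refine ⟨fun t => max (-M) (min M (hh.1.mk h t)),
    measurable_const.max (measurable_const.min hh.1.stronglyMeasurable_mk.measurable),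
    ⟨M, fun t => abs_le.2 ⟨le_max_left _ _, max_le (by linarith) (min_le_left _ _)⟩⟩, ?_⟩
  filter_upwards [hh.1.ae_eq_mk, ae_le_lpNorm_exponent_top hh] with t hmk hle
  rw [Real.norm_eq_abs, abs_le] at hle
  rw [← hmk, min_eq_right hle.2, max_eq_right hle.1]

lemma intervalIntegral_eq_integral_Icc {T : ℝ} (hT : 0 ≤ T) (f : ℝ → ℝ) :
    ∫ t in (0 : ℝ)..T, f t = ∫ t in Icc 0 T, f t := by
  rw [intervalIntegral.integral_of_le hT, integral_Icc_eq_integral_Ioc]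

lemma IsState.congr_ae {T α : ℝ} (hT : 0 ≤ T) {u w : ℝ → ℝ} {y : ℝ → ℝ → ℝ}
    (hy : IsState T α u y) (h : u =ᵐ[volume.restrict (Icc 0 T)] w) : IsState T α w y := by
  obtain ⟨g, hg, hweak⟩ := hy.weak
  refine ⟨hy.continuousOn, hy.initial, g, hg, fun v hv => ?_⟩
  rw [hweak v hv, intervalIntegral_eq_integral_Icc hT, intervalIntegral_eq_integral_Icc hT]
  exact integral_congr_ae (h.mono fun t ht => by simp only [ht])

theorem IsAdjointState.exists_state_duality {T α : ℝ} (hT : 0 < T) {d : ℝ → ℝ} {φ : ℝ → ℝ → ℝ}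
    (hφ : IsAdjointState T α d φ) {h : ℝ → ℝ} (hh : MemLp h ⊤ (volume.restrict (Icc 0 T))) :
    ∃ z : ℝ → ℝ → ℝ, IsState T α h z ∧
      ∫ x in Icc (0 : ℝ) 1, d x * z x T = ∫ t in Icc 0 T, φ 1 t * h t := by
  obtain ⟨h', hmeas, ⟨M, hM⟩, hae⟩ := exists_measurable_bounded_ae_eq hh
  obtain ⟨z, hz, hdual⟩ := hφ.exists_state_duality_of_bounded hT hmeas hM
  refine ⟨z, hz.congr_ae hT.le hae, ?_⟩
  rw [← intervalIntegral_eq_integral_Icc zero_le_one, hdual,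
    intervalIntegral_eq_integral_Icc hT.le]
  exact integral_congr_ae (hae.mono fun t ht => by simp only [ht])

/-! ### First-order optimality -/

lemma integral_add_const_mul_mul {β : Type*} [MeasurableSpace β] {ρ : Measure β} {f g v : β → ℝ}
    (hf : Integrable (fun p => f p * v p) ρ) (hg : Integrable (fun p => g p * v p) ρ) (s : ℝ) :
    ∫ p, (f p + s * g p) * v p ∂ρ = (∫ p, f p * v p ∂ρ) + s * ∫ p, g p * v p ∂ρ := by
  simp_rw [add_mul, mul_assoc]
  rw [integral_add hf (hg.const_mul s), integral_const_mul]

lemma intervalIntegral_add_const_mul_mul {a b : ℝ} {f g v : ℝ → ℝ}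
    (hf : IntervalIntegrable f volume a b) (hg : IntervalIntegrable g volume a b)
    (hv : Continuous v) (s : ℝ) :
    ∫ t in a..b, (f t + s * g t) * v t
      = (∫ t in a..b, f t * v t) + s * ∫ t in a..b, g t * v t := by
  simp_rw [add_mul, mul_assoc]
  rw [intervalIntegral.integral_add (hf.mul_continuousOn hv.continuousOn)
    ((hg.mul_continuousOn hv.continuousOn).const_mul s), intervalIntegral.integral_const_mul]

lemma HasWeakDerivX.add_const_mul {T : ℝ} {y z g k : ℝ → ℝ → ℝ}
    (hy : ContinuousOn (fun p : ℝ × ℝ => y p.1 p.2) (Icc (0 : ℝ) 1 ×ˢ Icc (0 : ℝ) T))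
    (hz : ContinuousOn (fun p : ℝ × ℝ => z p.1 p.2) (Icc (0 : ℝ) 1 ×ˢ Icc (0 : ℝ) T))
    (hg : HasWeakDerivX T y g) (hk : HasWeakDerivX T z k) (s : ℝ) :
    HasWeakDerivX T (fun x t => y x t + s * z x t) (fun x t => g x t + s * k x t) := by
  refine ⟨hg.1.add (hk.1.const_mul s), fun η hη hcomp hsupp => ?_⟩
  have hη2 := memLp_cylinder (T := T) hη.continuous.continuousOn 2
  have hη' := (continuous_deriv_fst hη).continuousOn (s := Icc (0 : ℝ) 1 ×ˢ Icc (0 : ℝ) T)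
  rw [integral_add_const_mul_mul (integrable_cylinder (hy.fun_mul hη'))
    (integrable_cylinder (hz.fun_mul hη')), integral_add_const_mul_mul (hg.1.integrable_mul hη2)
    (hk.1.integrable_mul hη2), hg.2 η hη hcomp hsupp, hk.2 η hη hcomp hsupp]
  ring

lemma IsState.add_const_mul {T α : ℝ} (hT : 0 ≤ T) {u h : ℝ → ℝ} {y z : ℝ → ℝ → ℝ}
    (hy : IsState T α u y) (hz : IsState T α h z) (hu : IntervalIntegrable u volume 0 T)
    (hh : IntervalIntegrable h volume 0 T) (s : ℝ) :
    IsState T α (fun t => u t + s * h t) (fun x t => y x t + s * z x t) := by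
  obtain ⟨g, hg, hyweak⟩ := hy.weak
  obtain ⟨k, hk, hzweak⟩ := hz.weak
  refine ⟨hy.continuousOn.add (hz.continuousOn.const_mul s),
    fun x hx => by rw [hy.initial x hx, hz.initial x hx, mul_zero, add_zero], _,
    hg.add_const_mul hy.continuousOn hz.continuousOn hk s, fun v hv => ?_⟩
  have hvx := memLp_cylinder (T := T) (continuous_deriv_fst hv).continuousOn 2
  have hvt := (continuous_deriv_snd hv).continuousOn (s := Icc (0 : ℝ) 1 ×ˢ Icc (0 : ℝ) T)
  rw [intervalIntegral_add_const_mul_mul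
      ((continuousOn_final hT hy.continuousOn).intervalIntegrable_of_Icc zero_le_one)
      ((continuousOn_final hT hz.continuousOn).intervalIntegrable_of_Icc zero_le_one)
      (continuous_slice_fst hv.continuous T),
    integral_add_const_mul_mul (integrable_cylinder (hy.continuousOn.fun_mul hvt))
      (integrable_cylinder (hz.continuousOn.fun_mul hvt)),
    integral_add_const_mul_mul (hg.1.integrable_mul hvx) (hk.1.integrable_mul hvx),
    intervalIntegral_add_const_mul_mul
      ((continuousOn_trace hy.continuousOn).intervalIntegrable_of_Icc hT)
      ((continuousOn_trace hz.continuousOn).intervalIntegrable_of_Icc hT)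
      (continuous_slice_snd hv.continuous 1),
    intervalIntegral_add_const_mul_mul hu hh (continuous_slice_snd hv.continuous 1)]
  linear_combination hyweak v hv + s * hzweak v hv

lemma integral_sq_add_const_mul {β : Type*} [MeasurableSpace β] {ρ : Measure β} {f g : β → ℝ}
    (hf : MemLp f 2 ρ) (hg : MemLp g 2 ρ) (s : ℝ) :
    ∫ x, |f x + s * g x| ^ 2 ∂ρ
      = (∫ x, |f x| ^ 2 ∂ρ) + 2 * s * (∫ x, f x * g x ∂ρ) + s ^ 2 * ∫ x, |g x| ^ 2 ∂ρ := by
  have hexpand (x : β) : |f x + s * g x| ^ 2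
      = |f x| ^ 2 + 2 * s * (f x * g x) + s ^ 2 * |g x| ^ 2 := by
    simp only [sq_abs]; ring
  have hff : Integrable (fun x => |f x| ^ 2) ρ := hf.integrable_norm_pow two_ne_zero
  have hgg : Integrable (fun x => |g x| ^ 2) ρ := hg.integrable_norm_pow two_ne_zero
  have hfg : Integrable (fun x => 2 * s * (f x * g x)) ρ := (hf.integrable_mul hg).const_mul _
  have hsum : Integrable (fun x => |f x| ^ 2 + 2 * s * (f x * g x)) ρ := hff.add hfg
  simp_rw [hexpand]
  rw [integral_add hsum (hgg.const_mul _), integral_add hff hfg, integral_const_mul,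
    integral_const_mul]

lemma integral_abs_add_mul_sub_le {β : Type*} [MeasurableSpace β] {ρ : Measure β} {u w : β → ℝ}
    (hu : Integrable u ρ) (hw : Integrable w ρ) {s : ℝ} (hs : s ∈ Icc 0 1) :
    ∫ t, |u t + s * (w t - u t)| ∂ρ ≤ (∫ t, |u t| ∂ρ) + s * ∫ t, (|w t| - |u t|) ∂ρ := by
  have hdiff : Integrable (fun t => s * (|w t| - |u t|)) ρ := (hw.abs.sub hu.abs).const_mul s
  rw [← integral_const_mul, ← integral_add hu.abs hdiff]
  refine integral_mono (hu.add ((hw.sub hu).const_mul s)).abs (hu.abs.add hdiff) fun t => ?_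
  calc |u t + s * (w t - u t)| = |(1 - s) * u t + s * w t| := by congr 1; ring
    _ ≤ |(1 - s) * u t| + |s * w t| := abs_add_le _ _
    _ = |u t| + s * (|w t| - |u t|) := by
        rw [abs_mul, abs_mul, abs_of_nonneg (sub_nonneg.2 hs.2), abs_of_nonneg hs.1]; ring

lemma memLp_Icc {a b : ℝ} {f : ℝ → ℝ} (hf : ContinuousOn f (Icc a b)) (r : ENNReal) :
    MemLp f r (volume.restrict (Icc a b)) := by
  obtain ⟨C, hC⟩ := isCompact_Icc.exists_bound_of_continuousOn hf
  exact MemLp.of_bound (hf.aestronglyMeasurable measurableSet_Icc) C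
    ((ae_restrict_mem measurableSet_Icc).mono hC)

lemma cost_add_const_mul_le {T ν μ : ℝ} (hT : 0 ≤ T) (hμ : 0 ≤ μ) {yΩ : ℝ → ℝ}
    {y z : ℝ → ℝ → ℝ} {u w : ℝ → ℝ} (hd : ContinuousOn (fun x => y x T - yΩ x) (Icc 0 1))
    (hz : ContinuousOn (fun x => z x T) (Icc 0 1)) (hu : MemLp u 2 (volume.restrict (Icc 0 T)))
    (hw : MemLp w 2 (volume.restrict (Icc 0 T))) {s : ℝ} (hs : s ∈ Icc 0 1) :
    cost T ν μ yΩ (fun x t => y x t + s * z x t) (fun t => u t + s * (w t - u t))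
      ≤ cost T ν μ yΩ y u
        + s * ((∫ x in Icc (0 : ℝ) 1, (y x T - yΩ x) * z x T)
          + ν * (∫ t in Icc 0 T, u t * (w t - u t)) + μ * ∫ t in Icc 0 T, (|w t| - |u t|))
        + s ^ 2 * (1 / 2 * (∫ x in Icc (0 : ℝ) 1, |z x T| ^ 2)
          + ν / 2 * ∫ t in Icc 0 T, |w t - u t| ^ 2) := by
  have hdir : MemLp (fun t => w t - u t) 2 (volume.restrict (Icc 0 T)) := hw.sub hu
  have hsparse := mul_le_mul_of_nonneg_left (integral_abs_add_mul_sub_le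
    (hu.integrable one_le_two) (hw.integrable one_le_two) hs) hμ
  simp only [cost, intervalIntegral_eq_integral_Icc hT,
    intervalIntegral_eq_integral_Icc zero_le_one, add_sub_right_comm _ (s * _)]
  rw [integral_sq_add_const_mul (memLp_Icc hd 2) (memLp_Icc hz 2),
    integral_sq_add_const_mul hu hdir]
  linarith

lemma IsAdmissible.memLp_top {T a b : ℝ} {u : ℝ → ℝ} (hu : IsAdmissible T a b u) :
    MemLp u ⊤ (volume.restrict (Icc 0 T)) :=
  memLp_top_of_bound hu.1.1 (max |a| |b|) (hu.2.mono fun _ ht => abs_le_max_abs_abs ht.1 ht.2)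

lemma IsAdmissible.add_mul_sub {T a b : ℝ} {u w : ℝ → ℝ} (hu : IsAdmissible T a b u)
    (hw : IsAdmissible T a b w) {s : ℝ} (hs : s ∈ Icc 0 1) :
    IsAdmissible T a b fun t => u t + s * (w t - u t) := by
  refine ⟨hu.1.add ((hw.1.sub hu.1).const_mul s), ?_⟩
  filter_upwards [hu.2, hw.2] with t hut hwt
  exact (convex_Icc a b).add_smul_sub_mem hut hwt hs

lemma nonneg_of_forall_quadratic {A B : ℝ} (h : ∀ s : ℝ, 0 < s → s ≤ 1 → 0 ≤ s * A + s ^ 2 * B) :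
    0 ≤ A := by
  have hlim : Tendsto (fun s : ℝ => A + s * B) (𝓝[>] 0) (𝓝 A) := by
    have hcont : Continuous fun s : ℝ => A + s * B := by fun_prop
    simpa using (hcont.tendsto 0).mono_left nhdsWithin_le_nhds
  refine ge_of_tendsto hlim ?_
  filter_upwards [Ioc_mem_nhdsGT (zero_lt_one (α := ℝ))] with s hs
  refine nonneg_of_mul_nonneg_right ?_ hs.1
  linarith [h s hs.1 hs.2, show s * (A + s * B) = s * A + s ^ 2 * B by ring]

theorem IsOptimal.variational {T α ν μ a b : ℝ} (hT : 0 < T) (hμ : 0 ≤ μ) {yΩ u : ℝ → ℝ}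
    {y φ : ℝ → ℝ → ℝ} (hopt : IsOptimal T α ν μ a b yΩ u y)
    (hφ : IsAdjointState T α (fun x => y x T - yΩ x) φ) {w : ℝ → ℝ} (hw : IsAdmissible T a b w) :
    0 ≤ ∫ t in Icc 0 T, ((φ 1 t + ν * u t) * (w t - u t) + μ * (|w t| - |u t|)) := by
  have hu := hopt.admissible
  have hdir2 := hw.1.sub hu.1
  obtain ⟨z, hz, hdual⟩ := hφ.exists_state_duality hT (hw.memLp_top.sub hu.memLp_top)
  have hd : ContinuousOn (fun x => y x T - yΩ x) (Icc 0 1) :=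
    (continuousOn_final hT.le hφ.continuousOn).congr fun x hx => (hφ.terminal x hx).symm
  have hint {f : ℝ → ℝ} (hf : MemLp f 2 (volume.restrict (Icc 0 T))) :
      IntervalIntegrable f volume 0 T :=
    (intervalIntegrable_iff_integrableOn_Icc_of_le hT.le).2 (hf.integrable one_le_two)
  have hfirst : 0 ≤ (∫ x in Icc (0 : ℝ) 1, (y x T - yΩ x) * z x T)
      + ν * (∫ t in Icc 0 T, u t * (w t - u t)) + μ * ∫ t in Icc 0 T, (|w t| - |u t|) := by
    refine nonneg_of_forall_quadratic (B := 1 / 2 * (∫ x in Icc (0 : ℝ) 1, |z x T| ^ 2)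
      + ν / 2 * ∫ t in Icc 0 T, |w t - u t| ^ 2) fun s hs0 hs1 => ?_
    have hs : s ∈ Icc 0 1 := ⟨hs0.le, hs1⟩
    have hmin := (hopt.minimal _ _ (hu.add_mul_sub hw hs)
      (hopt.state.add_const_mul hT.le hz (hint hu.1) (hint hdir2) s)).trans
      (cost_add_const_mul_le hT.le hμ hd (continuousOn_final hT.le hz.continuousOn) hu.1 hw.1 hs)
    linarith
  have hφu : Integrable (fun t => φ 1 t * (w t - u t)) (volume.restrict (Icc 0 T)) :=
    (memLp_Icc (continuousOn_trace hφ.continuousOn) 2).integrable_mul hdir2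
  have huu : Integrable (fun t => ν * (u t * (w t - u t))) (volume.restrict (Icc 0 T)) :=
    (hu.1.integrable_mul hdir2).const_mul ν
  have habs : Integrable (fun t => μ * (|w t| - |u t|)) (volume.restrict (Icc 0 T)) :=
    ((hw.1.integrable one_le_two).abs.sub (hu.1.integrable one_le_two).abs).const_mul μ
  have hsum : Integrable (fun t => φ 1 t * (w t - u t) + ν * (u t * (w t - u t)))
      (volume.restrict (Icc 0 T)) := hφu.add huu
  simp_rw [add_mul, mul_assoc]
  rw [integral_add hsum habs, integral_add hφu huu, integral_const_mul,
    integral_const_mul]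
  rw [hdual] at hfirst
  exact hfirst

/-! ### The scalar minimisation problem -/

/-- The projection of `r` onto the interval `[a,b]`. -/
def clamp (a b r : ℝ) : ℝ := max a (min b r)

lemma clamp_mem {a b : ℝ} (hab : a ≤ b) (r : ℝ) : clamp a b r ∈ Icc a b :=
  ⟨le_max_left _ _, max_le hab (min_le_left _ _)⟩

lemma clamp_of_le {a r : ℝ} (b : ℝ) (h : r ≤ a) : clamp a b r = a :=
  max_eq_left ((min_le_right _ _).trans h)

lemma clamp_of_ge {a b r : ℝ} (hab : a ≤ b) (h : b ≤ r) : clamp a b r = b := by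
  rw [clamp, min_eq_left h, max_eq_right hab]

lemma clamp_of_mem {a b r : ℝ} (h : r ∈ Icc a b) : clamp a b r = r := by
  rw [clamp, min_eq_right h.2, max_eq_right h.1]

lemma clamp_sub_mul_clamp_sub_nonpos {a b r : ℝ} (hr : r ∈ Icc a b) (c : ℝ) :
    (clamp a b c - c) * (clamp a b c - r) ≤ 0 := by
  rcases le_total c a with hca | hac
  · rw [clamp_of_le b hca]
    exact mul_nonpos_of_nonneg_of_nonpos (sub_nonneg.2 hca) (sub_nonpos.2 hr.1)
  · rcases le_total b c with hbc | hcb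
    · rw [clamp_of_ge (hr.1.trans hr.2) hbc]
      exact mul_nonpos_of_nonpos_of_nonneg (sub_nonpos.2 hbc) (sub_nonneg.2 hr.2)
    · rw [clamp_of_mem ⟨hac, hcb⟩, sub_self, zero_mul]

/-- The minimiser over `[a,b]` of `r ↦ p r + (ν/2) r² + μ |r|`. -/
noncomputable def shrink (ν μ a b p : ℝ) : ℝ :=
  clamp a b (-(1 / ν) * (p - clamp (-μ) μ p))

section Shrink

variable {ν μ a b p : ℝ}

lemma shrink_mem (hab : a ≤ b) : shrink ν μ a b p ∈ Icc a b := clamp_mem hab _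

lemma shrink_of_lt (hν : 0 < ν) (ha : a ≤ 0) (hb : 0 ≤ b) (hp : p < -μ - ν * b) :
    shrink ν μ a b p = b := by
  have hp' : p ≤ -μ := by linarith [mul_nonneg hν.le hb]
  have hle : b ≤ -(1 / ν) * (p - -μ) := by
    rw [neg_mul, ← mul_neg, one_div, le_inv_mul_iff₀ hν]; linarith
  rw [shrink, clamp_of_le _ hp', clamp_of_ge (ha.trans hb) hle]

lemma shrink_of_mem_left (hν : 0 < ν) (ha : a ≤ 0) (hp : p ∈ Icc (-μ - ν * b) (-μ)) :
    shrink ν μ a b p = -(1 / ν) * (p + μ) := by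
  have hle : -(1 / ν) * (p + μ) ≤ b := by
    rw [neg_mul, ← mul_neg, one_div, inv_mul_le_iff₀ hν]; linarith [hp.1]
  have hge : 0 ≤ -(1 / ν) * (p + μ) := by
    rw [neg_mul, ← mul_neg, one_div, le_inv_mul_iff₀ hν]; linarith [hp.2]
  rw [shrink, clamp_of_le _ hp.2, sub_neg_eq_add, clamp_of_mem ⟨ha.trans hge, hle⟩]

lemma shrink_of_mem_middle (ha : a ≤ 0) (hb : 0 ≤ b) (hp : p ∈ Icc (-μ) μ) :
    shrink ν μ a b p = 0 := by
  rw [shrink, clamp_of_mem hp, sub_self, mul_zero, clamp_of_mem ⟨ha, hb⟩]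

lemma shrink_of_mem_right (hν : 0 < ν) (hμ : 0 ≤ μ) (hb : 0 ≤ b) (hp : p ∈ Icc μ (μ - ν * a)) :
    shrink ν μ a b p = -(1 / ν) * (p - μ) := by
  have hge : a ≤ -(1 / ν) * (p - μ) := by
    rw [neg_mul, ← mul_neg, one_div, le_inv_mul_iff₀ hν]; linarith [hp.2]
  have hle : -(1 / ν) * (p - μ) ≤ 0 := by
    rw [neg_mul, ← mul_neg, one_div, inv_mul_le_iff₀ hν]; linarith [hp.1]
  rw [shrink, clamp_of_ge (neg_le_self hμ) hp.1, clamp_of_mem ⟨hge, hle.trans hb⟩]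

lemma shrink_of_gt (hν : 0 < ν) (hμ : 0 ≤ μ) (ha : a ≤ 0) (hp : μ - ν * a < p) :
    shrink ν μ a b p = a := by
  have hp' : μ ≤ p := by linarith [mul_nonpos_of_nonneg_of_nonpos hν.le ha]
  have hle : -(1 / ν) * (p - μ) ≤ a := by
    rw [neg_mul, ← mul_neg, one_div, inv_mul_le_iff₀ hν]; linarith
  rw [shrink, clamp_of_ge (neg_le_self hμ) hp', clamp_of_le _ hle]

/-- `-clamp (-μ) μ p` is a subgradient of `μ |·|` at `shrink ν μ a b p`. -/
lemma clamp_mul_shrink_add (hν : 0 < ν) (hμ : 0 ≤ μ) (ha : a ≤ 0) (hb : 0 ≤ b) :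
    clamp (-μ) μ p * shrink ν μ a b p + μ * |shrink ν μ a b p| = 0 := by
  rcases le_total p (-μ) with hlow | hlow
  · have hnonneg : 0 ≤ shrink ν μ a b p := by
      rw [shrink, clamp_of_le _ hlow]
      refine le_max_of_le_right (le_min hb ?_)
      exact mul_nonneg_of_nonpos_of_nonpos (by simpa using hν.le) (by linarith)
    rw [clamp_of_le _ hlow, abs_of_nonneg hnonneg, neg_mul, neg_add_cancel]
  · rcases le_total μ p with hhigh | hhigh
    · have hnonpos : shrink ν μ a b p ≤ 0 := by
        rw [shrink, clamp_of_ge (neg_le_self hμ) hhigh]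
        refine max_le ha ((min_le_right _ _).trans ?_)
        exact mul_nonpos_of_nonpos_of_nonneg (by simpa using hν.le) (by linarith)
      rw [clamp_of_ge (neg_le_self hμ) hhigh, abs_of_nonpos hnonpos, mul_neg, add_neg_cancel]
    · rw [shrink_of_mem_middle ha hb ⟨hlow, hhigh⟩, abs_zero, mul_zero, mul_zero, add_zero]

lemma shrink_variational (hν : 0 < ν) (hμ : 0 ≤ μ) (ha : a ≤ 0) (hb : 0 ≤ b) {r : ℝ}
    (hr : r ∈ Icc a b) :
    (p + ν * r) * (shrink ν μ a b p - r) + μ * (|shrink ν μ a b p| - |r|)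
      ≤ -ν * ((shrink ν μ a b p - r) * (shrink ν μ a b p - r)) := by
  set σ := clamp (-μ) μ p
  set w := shrink ν μ a b p
  have hproj : ν * ((w - -(1 / ν) * (p - σ)) * (w - r)) ≤ 0 :=
    mul_nonpos_of_nonneg_of_nonpos hν.le (clamp_sub_mul_clamp_sub_nonpos hr _)
  have hproj' : ν * ((w - -(1 / ν) * (p - σ)) * (w - r)) = (ν * w + p - σ) * (w - r) := by
    field_simp; ring
  have hsubgrad : σ * w + μ * |w| = 0 := clamp_mul_shrink_add hν hμ ha hb
  have hσr : -(σ * r) ≤ μ * |r| :=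
    calc -(σ * r) ≤ |σ| * |r| := by rw [← abs_mul]; exact neg_le_abs _
      _ ≤ μ * |r| :=
        mul_le_mul_of_nonneg_right (abs_le.2 (clamp_mem (neg_le_self hμ) p)) (abs_nonneg r)
  linarith

end Shrink

theorem IsOptimal.ae_eq_shrink {T α ν μ a b : ℝ} (hT : 0 < T) (hν : 0 < ν) (hμ : 0 ≤ μ)
    (ha : a ≤ 0) (hb : 0 ≤ b) {yΩ u : ℝ → ℝ} {y φ : ℝ → ℝ → ℝ}
    (hopt : IsOptimal T α ν μ a b yΩ u y)
    (hφ : IsAdjointState T α (fun x => y x T - yΩ x) φ) :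
    ∀ᵐ t ∂volume.restrict (Icc 0 T), u t = shrink ν μ a b (φ 1 t) := by
  set w : ℝ → ℝ := fun t => shrink ν μ a b (φ 1 t)
  have hφ1 := continuousOn_trace hφ.continuousOn
  have hshrink : Continuous (shrink ν μ a b) := by unfold shrink clamp; fun_prop
  have hw : IsAdmissible T a b w := ⟨memLp_Icc (hshrink.comp_continuousOn hφ1) 2,
    Eventually.of_forall fun t => shrink_mem (ha.trans hb)⟩
  have hu := hopt.admissible
  have hdir2 := hw.1.sub hu.1
  have hsq : Integrable (fun t => (w t - u t) * (w t - u t)) (volume.restrict (Icc 0 T)) :=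
    hdir2.integrable_mul hdir2
  have hint : Integrable (fun t => (φ 1 t + ν * u t) * (w t - u t) + μ * (|w t| - |u t|))
      (volume.restrict (Icc 0 T)) :=
    (((memLp_Icc hφ1 2).add (hu.1.const_mul ν)).integrable_mul hdir2).add
      (((hw.1.integrable one_le_two).abs.sub (hu.1.integrable one_le_two).abs).const_mul μ)
  have hle : 0 ≤ -ν * ∫ t in Icc 0 T, (w t - u t) * (w t - u t) := by
    rw [← integral_const_mul]
    exact (hopt.variational hT hμ hφ hw).trans (integral_mono_ae hint (hsq.const_mul (-ν))
      (hu.2.mono fun t ht => shrink_variational hν hμ ha hb ht))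
  have hzero : ∫ t in Icc 0 T, (w t - u t) * (w t - u t) = 0 :=
    le_antisymm (nonpos_of_mul_nonneg_right hle (neg_lt_zero.2 hν))
      (integral_nonneg fun t => mul_self_nonneg _)
  filter_upwards [(integral_eq_zero_iff_of_nonneg (fun t => mul_self_nonneg _) hsq).1 hzero]
    with t ht
  exact (sub_eq_zero.1 (mul_self_eq_zero.1 ht)).symm

end SparseHeatControl

theorem theorem3p9_general {T α ν μ a b : ℝ} (hT : 0 < T) (hν : 0 < ν) (hμ : 0 ≤ μ)
    (ha : a ≤ 0) (hb : 0 ≤ b) {yΩ u : ℝ → ℝ} {y φ : ℝ → ℝ → ℝ}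
    (hopt : SparseHeatControl.IsOptimal T α ν μ a b yΩ u y)
    (hφ : SparseHeatControl.IsAdjointState T α (fun x => y x T - yΩ x) φ) :
    ∀ᵐ t ∂(MeasureTheory.volume.restrict (Set.Icc (0 : ℝ) T)),
      (φ 1 t ∈ Set.Iio (-μ - ν * b) → u t = b) ∧
      (φ 1 t ∈ Set.Ioo (-μ - ν * b) (-μ) → u t = -(1 / ν) * (φ 1 t + μ)) ∧
      (φ 1 t ∈ Set.Ioo (-μ) μ → u t = 0) ∧
      (φ 1 t ∈ Set.Ioo μ (μ - ν * a) → u t = -(1 / ν) * (φ 1 t - μ)) ∧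
      (φ 1 t ∈ Set.Ioi (μ - ν * a) → u t = a) := by
  open SparseHeatControl in
  filter_upwards [hopt.ae_eq_shrink hT hν hμ ha hb hφ] with t ht
  rw [ht]
  exact ⟨shrink_of_lt hν ha hb, fun h => shrink_of_mem_left hν ha (Ioo_subset_Icc_self h),
    fun h => shrink_of_mem_middle ha hb (Ioo_subset_Icc_self h),
    fun h => shrink_of_mem_right hν hμ hb (Ioo_subset_Icc_self h), shrink_of_gt hν hμ ha⟩

theorem theorem3p9 (T α ν μ a b : ℝ) (hT : 0 < T) (hα : 0 ≤ α) (hν : 0 < ν) (hμ : 0 < μ)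
    (ha : a < 0) (hb : 0 < b)
    (yΩ : ℝ → ℝ) (hyΩ : ContinuousOn yΩ (Set.Icc (0 : ℝ) 1))
    (u : ℝ → ℝ) (y φ : ℝ → ℝ → ℝ)
    (hopt : SparseHeatControl.IsOptimal T α ν μ a b yΩ u y)
    (hφ : SparseHeatControl.IsAdjointState T α (fun x => y x T - yΩ x) φ) :
    ∀ᵐ t ∂(MeasureTheory.volume.restrict (Set.Icc (0 : ℝ) T)),
      (φ 1 t ∈ Set.Iio (-μ - ν * b) → u t = b) ∧
      (φ 1 t ∈ Set.Ioo (-μ - ν * b) (-μ) → u t = -(1 / ν) * (φ 1 t + μ)) ∧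
      (φ 1 t ∈ Set.Ioo (-μ) μ → u t = 0) ∧
      (φ 1 t ∈ Set.Ioo μ (μ - ν * a) → u t = -(1 / ν) * (φ 1 t - μ)) ∧
      (φ 1 t ∈ Set.Ioi (μ - ν * a) → u t = a) :=
  theorem3p9_general hT hν hμ.le ha.le hb.le hopt hφ
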